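/- Let $D\subset\mathbb C$ be a bounded Jordan domain with $0\in D$ whose boundary $\eta=\partial D$ (a Jordan curve) has zero area, and let $D^*=\mathbb C\smallsetminus\overline D$. Write $\mathbb D=\{|z|<1\}$ and $\mathbb D^*=\{|z|>1\}$. Let $f:\mathbb D\to D$ be the conformal map with $f(0)=0$ and $r_0=f'(0)>0$, and let $g:\mathbb D^*\to D^*$ be the conformal map with $g(z)=r_\infty z+\sum_{k\ge0}g_kz^{-k}$ and $r_\infty>0$. Define the Grunsky coefficients by $$\log\frac{g(\zeta)-g(z)}{r_\infty(\zeta-z)}=-\sum_{k,\ell\ge1}a_{k,\ell}\,\zeta^{-k}z^{-\ell}\quad(|\zeta|,|z|>1),\qquad \log\frac{f(\zeta)-f(z)}{\zeta-z}=-\sum_{k,\ell\ge0}a_{-k,-\ell}\,\zeta^{k}z^{\ell}\quad(|\zeta|,|z|<1),$$ where the logarithms are the continuous branches that vanish at $\zeta=z=\infty$ and equal $\log r_0\in\mathbb R$ at $\zeta=z=0$, respectively. For $n\ge1$ set $$Z_n(D)=\frac1{n!}\int_{D^n}\prod_{1\le k<\ell\le n}|z_k-z_\ell|^2\prod_{k=1}^nd^2z_k,\qquad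 Z_n^*(D^*)=\frac1{n!}\int_{(D^*)^n}e^{-(n+1)\sum_{k=1}^n\log|z_k|^2}\prod_{1\le k<\ell\le n}|z_k-z_\ell|^2\prod_{k=1}^nd^2z_k .$$ Then the matrices $B=(\sqrt{k\ell}\,a_{k,\ell})_{k,\ell\ge1}$ and $B_1=(\sqrt{k\ell}\,a_{-k,-\ell})_{k,\ell\ge1}$ define bounded operators on $\ell^2(\mathbb Z_+)$. If $P_n$ denotes the orthogonal projection of $\ell^2(\mathbb Z_+)$ onto the first $n$ coordinates, then for every $n\ge1$ both integrals converge, both partition functions and both determinants below are positive, and $$\log Z_n(D)=\log\frac{\pi^n}{n!}+n(n+1)\log r_\infty+\log\det(I-P_nBB^*P_n)_{\ell^2(\mathbb Z_+)},$$ $$\log Z_n^*(D^*)=\log\frac{\pi^n}{n!}-n(n+1)\log r_0+\log\det(I-P_nB_1B_1^*P_n)_{\ell^2(\mathbb Z_+)}.$$ -/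

import Mathlib

open MeasureTheory

/-- A bounded Jordan domain: a bounded, connected, open subset of the plane whose boundary is a
Jordan curve, i.e. the image of the circle under a continuous injective map. Equivalently, the
bounded component of the complement of a Jordan curve. -/
def IsBoundedJordanDomain (D : Set ℂ) : Prop :=
  IsOpen D ∧ IsConnected D ∧ Bornology.IsBounded D ∧
    ∃ γ : Circle → ℂ, Continuous γ ∧ Function.Injective γ ∧ Set.range γ = frontier D

/-- The exterior domain `D^*` (without the point at infinity). -/
def exteriorDomain (D : Set ℂ) : Set ℂ := (closure D)ᶜ

/-- `f` is the conformal map of the unit disc onto `D` with `f 0 = 0` and `f' 0 = r₀ > 0`;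
the number `r₀` is the conformal radius of `D` with respect to `0`. -/
structure IsInteriorConformalMap (D : Set ℂ) (f : ℂ → ℂ) (r₀ : ℝ) : Prop where
  differentiableOn : DifferentiableOn ℂ f (Metric.ball 0 1)
  injOn : Set.InjOn f (Metric.ball 0 1)
  image_eq : f '' Metric.ball 0 1 = D
  map_zero : f 0 = 0
  hasDerivAt_zero : HasDerivAt f (r₀ : ℂ) 0
  pos : 0 < r₀

/-- `g` is the conformal map of `{|z| > 1}` onto `D^*` with expansion
`g z = r z + c₀ + c₁ / z + c₂ / z ^ 2 + ⋯`, `r > 0`; the number `r` is the capacity of `D`. -/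
structure IsExteriorConformalMap (D : Set ℂ) (g : ℂ → ℂ) (r : ℝ) : Prop where
  differentiableOn : DifferentiableOn ℂ g {z | 1 < ‖z‖}
  injOn : Set.InjOn g {z | 1 < ‖z‖}
  image_eq : g '' {z | 1 < ‖z‖} = exteriorDomain D
  expansion : ∃ c : ℕ → ℂ, ∀ z : ℂ, 1 < ‖z‖ →
    HasSum (fun k : ℕ => c k * z⁻¹ ^ k) (g z - r * z)
  pos : 0 < r

/-- The coefficients `a k l`, `k, l ≥ 1`, of the expansion
`log ((g ζ - g z) / (r (ζ - z))) = - ∑ a k l ζ ^ (-k) z ^ (-l)` on `|ζ|, |z| > 1`.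
The sum of the series is a continuous logarithm that vanishes at infinity, so that the branch
and the coefficients are determined. -/
def IsExteriorGrunskyCoeff (g : ℂ → ℂ) (r : ℝ) (a : ℕ+ → ℕ+ → ℂ) : Prop :=
  ∀ ζ z : ℂ, 1 < ‖ζ‖ → 1 < ‖z‖ → ζ ≠ z →
    ∃ L : ℂ,
      HasSum (fun p : ℕ+ × ℕ+ => -(a p.1 p.2 * ζ⁻¹ ^ (p.1 : ℕ) * z⁻¹ ^ (p.2 : ℕ))) L ∧
      Complex.exp L = (g ζ - g z) / (r * (ζ - z))

/-- The coefficients `a k l` (written `a_{-k,-l}` in the literature), `k, l ≥ 0`, of the expansion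
`log ((f ζ - f z) / (ζ - z)) = - ∑ a k l ζ ^ k z ^ l` on `|ζ|, |z| < 1`; the branch of the
logarithm is the one that is real at `ζ = z = 0`, where its value is `log r₀ = log f' 0`. -/
def IsInteriorGrunskyCoeff (f : ℂ → ℂ) (r₀ : ℝ) (a : ℕ → ℕ → ℂ) : Prop :=
  a 0 0 = -(Real.log r₀ : ℂ) ∧
  ∀ ζ z : ℂ, ‖ζ‖ < 1 → ‖z‖ < 1 → ζ ≠ z →
    ∃ L : ℂ,
      HasSum (fun p : ℕ × ℕ => -(a p.1 p.2 * ζ ^ p.1 * z ^ p.2)) L ∧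
      Complex.exp L = (f ζ - f z) / (ζ - z)

/-- The Hilbert space `ℓ²(ℤ₊)`, with coordinates numbered `1, 2, 3, …`. -/
abbrev EllTwo : Type := lp (fun _ : ℕ+ => ℂ) 2

/-- The standard basis vector `e_k` of `ℓ²(ℤ₊)`. -/
noncomputable def ellBasis (k : ℕ+) : EllTwo := lp.single 2 k (1 : ℂ)

/-- The bounded operator `B` on `ℓ²(ℤ₊)` has the matrix `(√(k l) a k l)`, `k, l ≥ 1`. -/
def IsGrunskyOperator (a : ℕ+ → ℕ+ → ℂ) (B : EllTwo →L[ℂ] EllTwo) : Prop :=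
  ∀ k l : ℕ+, B (ellBasis l) k = (Real.sqrt ((k : ℝ) * (l : ℝ)) : ℂ) * a k l

/-- `P_n`: the orthogonal projection of `ℓ²(ℤ₊)` onto the first `n` coordinates. -/
noncomputable def truncProj (n : ℕ) : EllTwo →L[ℂ] EllTwo :=
  ∑ k ∈ Finset.range n,
    InnerProductSpace.rankOne ℂ (ellBasis k.succPNat) (ellBasis k.succPNat)

/-- `det(I - T)` for an operator `T` of finite rank: the determinant of `I - T` on the
(finite-dimensional, invariant) range of `T`. -/
noncomputable def detOneSub {E : Type*} [AddCommGroup E] [Module ℂ E] [TopologicalSpace E]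
    (T : E →L[ℂ] E) : ℂ :=
  LinearMap.det
    (LinearMap.id - (T : E →ₗ[ℂ] E).restrict
      (p := LinearMap.range (T : E →ₗ[ℂ] E)) (q := LinearMap.range (T : E →ₗ[ℂ] E))
      (fun x _ => LinearMap.mem_range_self (T : E →ₗ[ℂ] E) x))

/-- `det(I - P_n B B^* P_n)` on `ℓ²(ℤ₊)`. -/
noncomputable def truncDet (n : ℕ) (B : EllTwo →L[ℂ] EllTwo) : ℂ :=
  detOneSub (truncProj n ∘L B ∘L ContinuousLinearMap.adjoint B ∘L truncProj n)

/-- `∏_{k < l} |z_k - z_l|²`. -/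
noncomputable def coulombWeight (n : ℕ) (z : Fin n → ℂ) : ℝ :=
  ∏ k : Fin n, ∏ l ∈ Finset.Ioi k, ‖z k - z l‖ ^ 2

/-- `exp (-(n + 1) ∑_k log |z_k|²) ∏_{k < l} |z_k - z_l|²`. -/
noncomputable def exteriorCoulombWeight (n : ℕ) (z : Fin n → ℂ) : ℝ :=
  Real.exp (-((n : ℝ) + 1) * ∑ k : Fin n, Real.log (‖z k‖ ^ 2)) * coulombWeight n z

/-- The product set `Ω^n` in `ℂ^n`. -/
def configSpace (n : ℕ) (Ω : Set ℂ) : Set (Fin n → ℂ) := {z | ∀ k, z k ∈ Ω}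

/-- The partition function `Z_n(D)` of the Coulomb gas on `D` at inverse temperature `2`. -/
noncomputable def partitionFn (n : ℕ) (D : Set ℂ) : ℝ :=
  1 / (n.factorial : ℝ) * ∫ z in configSpace n D, coulombWeight n z

/-- The partition function `Z_n^*(Ω)` of the exterior Coulomb gas, for `Ω = D^*`. -/
noncomputable def exteriorPartitionFn (n : ℕ) (Ω : Set ℂ) : ℝ :=
  1 / (n.factorial : ℝ) * ∫ z in configSpace n Ω, exteriorCoulombWeight n z

/-! Since `∏ |z_k - z_l|²` is the squared modulus of a Vandermonde determinant, Andréief's identity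
turns `Z_n(D)` into the determinant of the moment matrix `∫_D w^i conj(w^j)`. This determinant can
be computed in any basis of polynomials of degree below `n`, and the good basis consists of the
derivatives of the Faber polynomials `F_m` of `g`.

`F_m` is the polynomial for which `F_m(g(z)) = z^m + ∑_{n≥1} β_{m,n} z^{-n}`. Its leading
coefficient is `r^{-m}`, so passing from monomials to `F_1', …, F_n'` multiplies the determinant by
`n!² r^{-n(n+1)}` (`det_faberGram`). Green's formula reduces the Gram integrals of the `F_j'` to
integrals over the circles `|z| = ρ`, Parseval's identity evaluates these, and `ρ → 1` gives `π (j
δ_{jk} - ∑ n β_{j,n} conj β_{k,n})` (`gram_faber_compl`). These integrals are over the complement of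
`g {|z| > 1}`, which is `D` up to a null set because the boundary has zero area.

The Grunsky coefficients are `a_{m,n} = β_{m,n} / m`: the generating series of the Faber polynomials
is a logarithmic derivative of `g(ζ) - g(z)` (`eval_faber`, `exp_tsum_faberTail`). Hence the Gram
matrix, divided by `π √(jk)`, is `I - B B^*` cut to its first `n` rows and columns. Positivity of
Gram matrices makes the rows of `B` contractive, which yields the bounded operator
(`norm_sum_grunskyRow_le`).

The second formula is the first one for `z ↦ 1 / f(1/z)`, which is univalent on `|z| > 1` with
leading coefficient `1/r₀`. The inversion `w = 1/z` carries the exterior weight on `D^*` to the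
plain weight on `1/D^*` (`exteriorPartitionFn_eq`), and the two maps have the same Grunsky
coefficients with both indices positive (`isInteriorGrunskyCoeff`). -/

namespace Grunsky

/-! ### Green's theorem outside a circle, and holomorphic change of variables. -/

section Green

open Complex Set Metric
open scoped Real Topology ComplexConjugate

/-- `2 i ∂V/∂z̄`, as a functional of the real derivative of `V`. -/
noncomputable def dbar (L : ℂ →L[ℝ] ℂ) : ℂ := I * L 1 - L I

theorem continuous_dbar : Continuous dbar := by
  unfold dbar; fun_prop

theorem measurable_norm_gt (ρ : ℝ) : MeasurableSet {z : ℂ | ρ < ‖z‖} :=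
  (isOpen_lt continuous_const continuous_norm).measurableSet

theorem real_clm_apply (L : ℂ →L[ℝ] ℂ) (w : ℂ) : L w = w.re * L 1 + w.im * L I := by
  conv_lhs => rw [← re_add_im w]
  rw [map_add]
  congr 1
  · have : (w.re : ℂ) = w.re • (1 : ℂ) := by simp
    rw [this, map_smul]; simp
  · have : (w.im : ℂ) * I = w.im • I := by simp
    rw [this, map_smul]; simp

/-- The chain rule for `∂/∂z̄` and a holomorphic inner function. -/
theorem dbar_comp_holomorphic (L : ℂ →L[ℝ] ℂ) (a : ℂ) :
    dbar (L ∘L ((ContinuousLinearMap.toSpanSingleton ℂ a).restrictScalars ℝ)) = conj a * dbar L := by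
  simp only [dbar, ContinuousLinearMap.comp_apply, ContinuousLinearMap.coe_restrictScalars',
    ContinuousLinearMap.toSpanSingleton_apply, smul_eq_mul, one_mul]
  rw [real_clm_apply L a, real_clm_apply L (I * a)]
  have : conj a = a.re - a.im * I := by
    apply Complex.ext <;> simp
  rw [this]
  simp only [mul_re, I_re, I_im, mul_im]
  push_cast
  ring_nf
  simp only [I_sq]
  ring

/-- This is the product rule for a holomorphic factor: by the Cauchy–Riemann equations `dbar` kills
the complex-linear term. -/
theorem dbar_smul_holomorphic (L : ℂ →L[ℝ] ℂ) (a b c : ℂ) :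
    dbar (a • L + c • (ContinuousLinearMap.toSpanSingleton ℂ b).restrictScalars ℝ) = a * dbar L := by
  simp [dbar]; ring

theorem abs_det_toSpanSingleton (a : ℂ) :
    |((ContinuousLinearMap.toSpanSingleton ℂ a).restrictScalars ℝ).det| = ‖a‖ ^ 2 := by
  have : ((ContinuousLinearMap.toSpanSingleton ℂ a).restrictScalars ℝ).det
      = LinearMap.det (Algebra.lmul ℝ ℂ a) := by
    unfold ContinuousLinearMap.det
    congr 1
    ext; simp [mul_comm]
  rw [this, ← Algebra.norm_apply, Algebra.norm_complex_apply, abs_of_nonneg (normSq_nonneg _),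
    normSq_eq_norm_sq]

theorem integral_image_holomorphic {s : Set ℂ} (hs : MeasurableSet s) {g g' : ℂ → ℂ}
    (hg : ∀ z ∈ s, HasDerivAt g (g' z) z) (hinj : InjOn g s) (F : ℂ → ℂ) :
    ∫ w in g '' s, F w = ∫ z in s, (‖g' z‖ ^ 2 : ℝ) * F (g z) := by
  rw [integral_image_eq_integral_abs_det_fderiv_smul (μ := volume) (E := ℂ) hs
    (f := g) (f' := fun z => (ContinuousLinearMap.toSpanSingleton ℂ (g' z)).restrictScalars ℝ)
    (fun z hz => ((hg z hz).hasFDerivAt.restrictScalars ℝ).hasFDerivWithinAt) hinj]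
  simp_rw [abs_det_toSpanSingleton, real_smul]

theorem integrableOn_image_holomorphic {s : Set ℂ} (hs : MeasurableSet s) {g g' : ℂ → ℂ}
    (hg : ∀ z ∈ s, HasDerivAt g (g' z) z) (hinj : InjOn g s) (F : ℂ → ℂ) :
    IntegrableOn F (g '' s) ↔ IntegrableOn (fun z => ((‖g' z‖ ^ 2 : ℝ) : ℂ) * F (g z)) s := by
  rw [integrableOn_image_iff_integrableOn_abs_det_fderiv_smul (μ := volume) (E := ℂ) hs
    (f := g) (f' := fun z => (ContinuousLinearMap.toSpanSingleton ℂ (g' z)).restrictScalars ℝ)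
    (fun z hz => ((hg z hz).hasFDerivAt.restrictScalars ℝ).hasFDerivWithinAt) hinj]
  simp_rw [abs_det_toSpanSingleton, real_smul]

/-- The half-open strip makes `exp` a bijection onto the annulus, so polar integration becomes
integration over a rectangle. -/
theorem exp_image_strip (a b : ℝ) :
    cexp '' (Ioo a b ×ℂ Ioc (-π) π) = {z | Real.exp a < ‖z‖ ∧ ‖z‖ < Real.exp b} := by
  ext z
  constructor
  · rintro ⟨w, hw, rfl⟩
    rw [mem_reProdIm] at hw
    simpa [norm_exp] using hw.1
  · rintro ⟨h1, h2⟩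
    have hz : z ≠ 0 := by
      rintro rfl; simp at h1; linarith [Real.exp_pos a]
    refine ⟨log z, ?_, exp_log hz⟩
    rw [mem_reProdIm]
    refine ⟨⟨?_, ?_⟩, ?_⟩
    · rw [log_re, Real.lt_log_iff_exp_lt (by positivity)]; exact h1
    · rw [log_re, Real.log_lt_iff_lt_exp (by positivity)]; exact h2
    · rw [log_im]; exact arg_mem_Ioc z

theorem exp_injOn_strip (a b : ℝ) : InjOn cexp (Ioo a b ×ℂ Ioc (-π) π) := by
  intro z hz w hw h
  rw [mem_reProdIm] at hz hw
  rw [← log_exp hz.2.1 hz.2.2, ← log_exp hw.2.1 hw.2.2, h]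

theorem integral_reProdIm_eq {a b c d : ℝ} (hab : a ≤ b) (hcd : c ≤ d) {F : ℂ → ℂ}
    (hF : IntegrableOn F (Icc a b ×ℂ Icc c d)) :
    ∫ z in Ioo a b ×ℂ Ioc c d, F z = ∫ x in a..b, ∫ y in c..d, F (x + y * I) := by
  rw [intervalIntegral.integral_of_le hab, integral_Ioc_eq_integral_Ioo]
  simp_rw [intervalIntegral.integral_of_le hcd]
  have e := Complex.volume_preserving_equiv_real_prod.symm
  have h1 : ∀ s t : Set ℝ, Complex.measurableEquivRealProd.symm ⁻¹' (s ×ℂ t) = s ×ˢ t := by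
    intro s t; ext p; simp [mem_reProdIm, measurableEquivRealProd]
  rw [← e.setIntegral_preimage_emb (MeasurableEquiv.measurableEmbedding _), h1,
    Measure.volume_eq_prod, setIntegral_prod]
  · refine setIntegral_congr_fun measurableSet_Ioo fun x _ => ?_
    refine setIntegral_congr_fun measurableSet_Ioc fun y _ => ?_
    exact congrArg F (mk_eq_add_mul_I x y)
  · have h2 := (e.integrableOn_comp_preimage (MeasurableEquiv.measurableEmbedding _)).2 hF
    rw [h1, Measure.volume_eq_prod] at h2
    exact h2.mono_set (prod_mono Ioo_subset_Icc_self Ioc_subset_Icc_self)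

/-- Green's theorem on the exterior of a circle, for functions that vanish near infinity. -/
theorem integral_dbar_exterior_circle {V : ℂ → ℂ} (hV : ContDiffOn ℝ 1 V {z | 1 < ‖z‖})
    {ρ S : ℝ} (hρ : 1 < ρ) (hρS : ρ < S) (h0 : ∀ z, S ≤ ‖z‖ → V z = 0) :
    ∫ z in {z | ρ < ‖z‖}, dbar (fderiv ℝ V z) = -∮ z in C(0, ρ), V z := by
  have hopen : IsOpen {z : ℂ | 1 < ‖z‖} := isOpen_lt continuous_const continuous_norm
  obtain ⟨a, rfl⟩ : ∃ a, Real.exp a = ρ := ⟨Real.log ρ, Real.exp_log (by linarith)⟩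
  obtain ⟨b, rfl⟩ : ∃ b, Real.exp b = S := ⟨Real.log S, Real.exp_log (by linarith)⟩
  have hab : a < b := Real.exp_lt_exp.1 hρS
  have ha : 0 < a := by simpa using hρ
  have hd : ∀ z : ℂ, 1 < ‖z‖ → HasFDerivAt V (fderiv ℝ V z) z := fun z hz =>
    ((hV.differentiableOn one_ne_zero).differentiableAt (hopen.mem_nhds hz)).hasFDerivAt
  have hc := hV.continuousOn_fderiv_of_isOpen hopen le_rfl
  have hnorm : ∀ ζ : ℂ, a ≤ ζ.re → 1 < ‖cexp ζ‖ := fun ζ h => by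
    rw [norm_exp]; exact hρ.trans_le (Real.exp_le_exp.2 h)
  -- `F dζ` is the pullback of `V dz` under `exp`. The factor `cexp ζ` makes `dbar F` equal to the
  -- Jacobian times `dbar V`.
  set F : ℂ → ℂ := fun ζ => cexp ζ * V (cexp ζ) with hFdef
  set F' : ℂ → ℂ →L[ℝ] ℂ := fun ζ =>
    cexp ζ • ((fderiv ℝ V (cexp ζ)) ∘L
      ((ContinuousLinearMap.toSpanSingleton ℂ (cexp ζ)).restrictScalars ℝ))
    + V (cexp ζ) • (ContinuousLinearMap.toSpanSingleton ℂ (cexp ζ)).restrictScalars ℝ with hF'def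
  have hFd : ∀ ζ : ℂ, a ≤ ζ.re → HasFDerivAt F (F' ζ) ζ := by
    intro ζ hζ
    have he : HasFDerivAt cexp
        ((ContinuousLinearMap.toSpanSingleton ℂ (cexp ζ)).restrictScalars ℝ) ζ :=
      (Complex.hasDerivAt_exp ζ).hasFDerivAt.restrictScalars ℝ
    exact he.mul ((hd _ (hnorm ζ hζ)).comp ζ he)
  have hdb : ∀ ζ, dbar (F' ζ) = (‖cexp ζ‖ ^ 2 : ℝ) * dbar (fderiv ℝ V (cexp ζ)) := by
    intro ζ
    rw [hF'def, dbar_smul_holomorphic, dbar_comp_holomorphic, ← mul_assoc, mul_conj,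
      normSq_eq_norm_sq]
  have hcont : ContinuousOn (fun ζ => dbar (F' ζ)) (Icc a b ×ℂ Icc (-π) π) := by
    simp_rw [hdb]
    refine ContinuousOn.mul (by fun_prop) (continuous_dbar.comp_continuousOn
      (hc.comp (by fun_prop) fun ζ hζ => hnorm ζ (mem_reProdIm.1 hζ).1.1))
  have hint : IntegrableOn (fun ζ => dbar (F' ζ)) (Icc a b ×ℂ Icc (-π) π) :=
    hcont.integrableOn_compact (isCompact_Icc.reProdIm isCompact_Icc)
  have hpi : -π ≤ π := by linarith [Real.pi_pos]
  have key := integral_boundary_rect_of_continuousOn_of_hasFDerivAt_real F F'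
    (⟨a, -π⟩ : ℂ) (⟨b, π⟩ : ℂ)
    (fun ζ hζ => by
      rw [uIcc_of_le hab.le, uIcc_of_le hpi, mem_reProdIm] at hζ
      exact (hFd ζ hζ.1.1).continuousAt.continuousWithinAt)
    (fun ζ hζ => by
      simp only [min_eq_left hab.le, mem_reProdIm] at hζ
      exact hFd ζ hζ.1.1.le)
    (by rw [uIcc_of_le hab.le, uIcc_of_le hpi]; exact hint)
  -- The horizontal sides cancel by periodicity and the right side lies where `V = 0`; only the left
  -- side, the circle of radius `ρ`, remains.
  have hper : ∀ x : ℝ, F (x + π * I) = F (x + (-π : ℝ) * I) := by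
    intro x
    have : cexp (x + π * I) = cexp (x + (-π : ℝ) * I) := by
      rw [exp_add, exp_add, exp_pi_mul_I]; push_cast; rw [neg_mul, exp_neg, exp_pi_mul_I]; norm_num
    simp only [hFdef, this]
  have hright : ∀ y : ℝ, F (b + y * I) = 0 := by
    intro y
    have : V (cexp (b + y * I)) = 0 := h0 _ (by rw [norm_exp]; simp)
    simp [hFdef, this]
  simp only [hper, hright, sub_self, intervalIntegral.integral_zero, smul_zero, zero_add,
    zero_sub] at key
  have hR : (∫ x in a..b, ∫ y in (-π)..π, I • F' (x + y * I) 1 - F' (x + y * I) I)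
      = ∫ z in {z | Real.exp a < ‖z‖}, dbar (fderiv ℝ V z) := by
    have h1 := integral_reProdIm_eq hab.le hpi hint
    have h2 : (∫ x in a..b, ∫ y in (-π)..π, I • F' (x + y * I) 1 - F' (x + y * I) I)
      = ∫ x in a..b, ∫ y in (-π)..π, dbar (F' (x + y * I)) := rfl
    rw [h2, ← h1]
    simp_rw [hdb]
    have hms : MeasurableSet (Ioo a b ×ℂ Ioc (-π) π) :=
      (measurable_re measurableSet_Ioo).inter (measurable_im measurableSet_Ioc)
    rw [← integral_image_holomorphic hms (fun z _ => Complex.hasDerivAt_exp z)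
      (exp_injOn_strip a b) (fun w => dbar (fderiv ℝ V w)), exp_image_strip]
    -- The annulus may replace the whole exterior: `V` vanishes near every point beyond the outer
    -- circle, and that circle is null.
    refine (setIntegral_eq_of_subset_of_ae_sdiff_eq_zero
      (measurable_norm_gt _).nullMeasurableSet (fun z hz => hz.1) ?_).symm
    have hsph : ∀ᵐ z : ℂ, z ∉ sphere (0 : ℂ) (Real.exp b) :=
      measure_eq_zero_iff_ae_notMem.1 (Measure.addHaar_sphere volume _ _)
    filter_upwards [hsph] with z hz hz2
    have h3 : Real.exp b ≤ ‖z‖ := by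
      by_contra h; exact hz2.2 ⟨hz2.1, not_le.1 h⟩
    have h4 : Real.exp b < ‖z‖ := lt_of_le_of_ne h3 fun h => hz (by simp [h])
    have : V =ᶠ[𝓝 z] fun _ => 0 := by
      filter_upwards [(isOpen_lt continuous_const continuous_norm).mem_nhds h4] with w hw
      exact h0 w (le_of_lt hw)
    rw [this.fderiv_eq]; simp [dbar]
  rw [← hR, ← key, circleIntegral]
  have hL : ∀ y : ℝ, I * F (a + y * I) =
      deriv (circleMap 0 (Real.exp a)) y • V (circleMap 0 (Real.exp a) y) := by
    intro y
    have : cexp (a + y * I) = circleMap 0 (Real.exp a) y := by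
      simp [circleMap, exp_add]
    simp only [hFdef, this, deriv_circleMap, smul_eq_mul]; ring
  rw [neg_inj, smul_eq_mul, ← intervalIntegral.integral_const_mul]
  simp_rw [hL]
  have hp : Function.Periodic (fun y : ℝ => deriv (circleMap 0 (Real.exp a)) y •
      V (circleMap 0 (Real.exp a) y)) (2 * π) := by
    intro y
    simp only [deriv_circleMap, periodic_circleMap 0 (Real.exp a) y]
  have := hp.intervalIntegral_add_eq (-π) 0
  rw [show -π + 2 * π = π by ring, zero_add] at this
  exact this

/-- Each directional derivative integrates to zero, by parts against the constant `1`. -/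
theorem integral_dbar_eq_zero {W : ℂ → ℂ} (hW : ContDiff ℝ 1 W) (hs : HasCompactSupport W) :
    ∫ z, dbar (fderiv ℝ W z) = 0 := by
  have hc : Continuous (fderiv ℝ W) := hW.continuous_fderiv one_ne_zero
  have hi : ∀ v, Integrable (fun z => fderiv ℝ W z v) := fun v =>
    (hc.clm_apply continuous_const).integrable_of_hasCompactSupport (hs.fderiv_apply ℝ v)
  have h0 : ∀ v, ∫ z, fderiv ℝ W z v = 0 := by
    intro v
    have := integral_mul_fderiv_eq_neg_fderiv_mul_of_integrable (μ := volume) (E := ℂ) (𝕜 := ℂ)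
      (f := fun _ => 1) (g := W) (v := v) (by simp) (by simpa using hi v)
      (by simpa using hW.continuous.integrable_of_hasCompactSupport hs) (fun x _ => by fun_prop)
      (fun x _ => hW.differentiable one_ne_zero x)
    simpa using this
  unfold dbar
  rw [integral_sub ((hi 1).const_mul I) (hi I), integral_const_mul, h0, h0]; simp

end Green

/-! ### Univalent maps of `|z| > 1` and Green's formula for the complement of their image. -/

section ExteriorMap

open Complex Set Metric
open scoped Real Topology ComplexConjugate

/-- Terms at radius `t` are bounded, and the geometric factor `(s/t)^k` absorbs the `k` produced by
differentiation. -/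
theorem summable_norm_mul_pow_of_summable {c : ℕ → ℂ} {s t : ℝ} (hs : 0 ≤ s) (hst : s < t)
    (h : Summable fun k => c k * (t : ℂ) ^ k) : Summable fun k : ℕ => (k : ℝ) * ‖c k‖ * s ^ (k - 1) := by
  have ht : 0 < t := hs.trans_lt hst
  obtain ⟨M, hM⟩ := h.tendsto_atTop_zero.norm.bddAbove_range
  have h1 : Summable fun k : ℕ => (k : ℝ) ^ 1 * (s / t) ^ k :=
    summable_pow_mul_geometric_of_norm_lt_one 1 (by
      rw [Real.norm_of_nonneg (by positivity)]; exact (div_lt_one ht).2 hst)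
  rcases hs.eq_or_lt with rfl | hs
  · refine summable_of_ne_finset_zero (s := Finset.range 2) fun k hk => ?_
    rw [Finset.mem_range, not_lt] at hk
    rw [zero_pow (by omega), mul_zero]
  refine Summable.of_nonneg_of_le (fun k => by positivity) (fun k => ?_) (h1.mul_left (M / s))
  have h2 : ‖c k‖ * t ^ k ≤ M := by
    have := hM ⟨k, rfl⟩
    simpa [abs_of_pos ht] using this
  rcases k with _ | k
  · simp
  have h3 : ‖c (k + 1)‖ ≤ M / t ^ (k + 1) := (le_div_iff₀ (by positivity)).2 h2
  calc ((k + 1 : ℕ) : ℝ) * ‖c (k + 1)‖ * s ^ (k + 1 - 1)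
      ≤ ((k + 1 : ℕ) : ℝ) * (M / t ^ (k + 1)) * s ^ (k + 1 - 1) := by gcongr
    _ = M / s * (((k + 1 : ℕ) : ℝ) ^ 1 * (s / t) ^ (k + 1)) := by
      rw [div_pow]; simp only [add_tsub_cancel_right]; field_simp; ring

theorem summable_norm_deriv_powerSeries {c : ℕ → ℂ}
    (h : ∀ v : ℂ, ‖v‖ < 1 → Summable fun k => c k * v ^ k) {v : ℂ} (hv : ‖v‖ < 1) :
    Summable fun k : ℕ => ‖(k : ℂ) * c k * v ^ (k - 1)‖ := by
  obtain ⟨t, h1, h2⟩ := exists_between hv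
  have := summable_norm_mul_pow_of_summable (norm_nonneg v) h1 (h t (by
    rwa [norm_real, Real.norm_of_nonneg ((norm_nonneg v).trans h1.le)]))
  simpa using this

theorem hasDerivAt_powerSeries {c : ℕ → ℂ}
    (h : ∀ v : ℂ, ‖v‖ < 1 → Summable fun k => c k * v ^ k) {v : ℂ} (hv : ‖v‖ < 1) :
    HasDerivAt (fun v => ∑' k, c k * v ^ k) (∑' k : ℕ, k * c k * v ^ (k - 1)) v := by
  obtain ⟨s, h1, h2⟩ := exists_between hv
  obtain ⟨t, h3, h4⟩ := exists_between h2
  have hs : 0 ≤ s := (norm_nonneg v).trans h1.le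
  refine hasDerivAt_tsum_of_isPreconnected (t := ball 0 s) (y₀ := 0)
    (g := fun k v => c k * v ^ k) (g' := fun k v => k * c k * v ^ (k - 1))
    (summable_norm_mul_pow_of_summable hs h3 (h t (by
      rwa [norm_real, Real.norm_of_nonneg (hs.trans h3.le)])))
    isOpen_ball (convex_ball _ _).isPreconnected (fun k w _ => ?_) (fun k w hw => ?_)
    (by simp [(norm_nonneg v).trans_lt h1]) (h 0 (by simp)) (by simpa using h1)
  · have := (hasDerivAt_pow k w).const_mul (c k)
    rwa [← mul_assoc, mul_comm (c k)] at this
  · rw [norm_mul, norm_mul, norm_pow, Complex.norm_natCast]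
    have : ‖w‖ ≤ s := by simpa using (mem_ball_zero_iff.1 hw).le
    gcongr

theorem differentiableOn_powerSeries {c : ℕ → ℂ}
    (h : ∀ v : ℂ, ‖v‖ < 1 → Summable fun k => c k * v ^ k) :
    DifferentiableOn ℂ (fun v => ∑' k, c k * v ^ k) (ball 0 1) := fun _ hv =>
  (hasDerivAt_powerSeries h (mem_ball_zero_iff.1 hv)).differentiableAt.differentiableWithinAt

theorem hasSum_taylor_ball {h : ℂ → ℂ} (hh : DifferentiableOn ℂ h (ball 0 1)) {v : ℂ}
    (hv : ‖v‖ < 1) : HasSum (fun n : ℕ => iteratedDeriv n h 0 / n.factorial * v ^ n) (h v) := by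
  have := Complex.hasSum_taylorSeries_on_ball hh (mem_ball_zero_iff.2 hv)
  refine this.congr_fun fun n => ?_
  simp only [sub_zero, smul_eq_mul]; ring

/-- A univalent function on `{|z| > 1}` with expansion `g z = r z + c₀ + c₁ / z + ⋯`, `r > 0`. -/
structure IsUnivalentAtInfinity (g : ℂ → ℂ) (r : ℝ) (c : ℕ → ℂ) : Prop where
  differentiableOn : DifferentiableOn ℂ g {z | 1 < ‖z‖}
  injOn : Set.InjOn g {z | 1 < ‖z‖}
  expansion : ∀ z : ℂ, 1 < ‖z‖ → HasSum (fun k : ℕ => c k * z⁻¹ ^ k) (g z - r * z)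
  pos : 0 < r

variable {g : ℂ → ℂ} {r : ℝ} {c : ℕ → ℂ}

theorem isOpen_norm_gt (ρ : ℝ) : IsOpen {z : ℂ | ρ < ‖z‖} :=
  isOpen_lt continuous_const continuous_norm

namespace IsUnivalentAtInfinity

theorem summable (hg : IsUnivalentAtInfinity g r c) (v : ℂ) (hv : ‖v‖ < 1) :
    Summable fun k => c k * v ^ k := by
  by_cases h : v = 0
  · subst h
    exact summable_of_ne_finset_zero (s := {0}) fun k hk => by
      simp [show k ≠ 0 by simpa using hk]
  · have := (hg.expansion v⁻¹ (by
      rw [norm_inv]; exact (one_lt_inv₀ (by positivity)).2 hv)).summable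
    simpa using this

theorem eq_add_tsum (hg : IsUnivalentAtInfinity g r c) {z : ℂ} (hz : 1 < ‖z‖) :
    g z = r * z + ∑' k, c k * z⁻¹ ^ k := by
  rw [(hg.expansion z hz).tsum_eq]; ring

theorem hasDerivAt (hg : IsUnivalentAtInfinity g r c) {z : ℂ} (hz : 1 < ‖z‖) :
    HasDerivAt g (deriv g z) z :=
  (hg.differentiableOn.differentiableAt ((isOpen_norm_gt 1).mem_nhds hz)).hasDerivAt

theorem exists_bound_near_zero (hg : IsUnivalentAtInfinity g r c) :
    ∃ S > 1, ∃ M > 0, ∀ v : ℂ, ‖v‖ ≤ S⁻¹ → ‖∑' k, c k * v ^ k‖ ≤ M := by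
  have hc : ContinuousOn (fun v => ∑' k, c k * v ^ k) (closedBall (0 : ℂ) 2⁻¹) :=
    (differentiableOn_powerSeries hg.summable).continuousOn.mono
      (closedBall_subset_ball (by norm_num))
  obtain ⟨M, hM⟩ := (isCompact_closedBall (0 : ℂ) 2⁻¹).exists_bound_of_continuousOn hc
  exact ⟨2, by norm_num, max M 1, by positivity, fun v hv => (hM v (by simpa using hv)).trans
    (le_max_left _ _)⟩

theorem exists_norm_ge (hg : IsUnivalentAtInfinity g r c) (K : ℝ) :
    ∃ S > 1, ∀ z : ℂ, S ≤ ‖z‖ → K ≤ ‖g z‖ := by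
  obtain ⟨S, hS, M, hM, h⟩ := hg.exists_bound_near_zero
  refine ⟨max S ((K + M) / r), by simp [hS], fun z hz => ?_⟩
  have hz1 : S ≤ ‖z‖ := (le_max_left _ _).trans hz
  have hz2 : K + M ≤ r * ‖z‖ := by
    have := (div_le_iff₀ hg.pos).1 ((le_max_right _ _).trans hz); linarith
  rw [hg.eq_add_tsum (hS.trans_le hz1)]
  have h1 := h z⁻¹ (by rw [norm_inv]; gcongr)
  have h2 := norm_sub_le_norm_add (r * z) (∑' k, c k * z⁻¹ ^ k)
  rw [norm_mul, norm_real, Real.norm_of_nonneg hg.pos.le] at h2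
  linarith

/-- In the chart at infinity `1 / g(1/v) = v / (r + v G(v))` is analytic and nonconstant at `0`, so
by the open mapping theorem its image contains a neighbourhood of `0`; hence `g` covers a
neighbourhood of infinity. -/
theorem exists_compl_image_subset (hg : IsUnivalentAtInfinity g r c) {ρ : ℝ} (hρ : 1 ≤ ρ) :
    ∃ R, (g '' {z | ρ < ‖z‖})ᶜ ⊆ closedBall 0 R := by
  set G : ℂ → ℂ := fun v => ∑' k, c k * v ^ k with hG
  have hGd := differentiableOn_powerSeries hg.summable
  set k : ℂ → ℂ := fun v => v / (r + v * G v) with hk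
  have hr : (r : ℂ) ≠ 0 := by exact_mod_cast hg.pos.ne'
  have hGa : AnalyticAt ℂ G 0 := hGd.analyticAt (ball_mem_nhds 0 one_pos)
  have hden : AnalyticAt ℂ (fun v => r + v * G v) 0 := analyticAt_const.add (analyticAt_id.mul hGa)
  have hka : AnalyticAt ℂ k 0 := analyticAt_id.div hden (by simpa using hr)
  have hne : ∀ᶠ v in 𝓝 (0 : ℂ), (r : ℂ) + v * G v ≠ 0 :=
    hden.continuousAt.eventually_ne (by simpa using hr)
  have hmap : 𝓝 (k 0) ≤ Filter.map k (𝓝 0) := by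
    refine hka.eventually_constant_or_nhds_le_map_nhds.resolve_left fun h => ?_
    have h1 : ∀ᶠ v in 𝓝 (0 : ℂ), v = 0 := by
      filter_upwards [h, hne] with v h1 h2
      simpa [hk, h2] using h1
    have h2 : ({0} : Set ℂ) ∈ 𝓝 (0 : ℂ) := by filter_upwards [h1] with v hv using hv
    have h3 := isOpen_singleton_iff_nhds_eq_pure (0 : ℂ) |>.2 (le_antisymm
      (Filter.le_pure_iff.2 h2) (pure_le_nhds _))
    exact not_isOpen_singleton (0 : ℂ) h3
  have hball : k '' ball 0 ρ⁻¹ ∈ 𝓝 (0 : ℂ) := by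
    have := hmap (Filter.image_mem_map (ball_mem_nhds (0 : ℂ) (inv_pos.2 (one_pos.trans_le hρ))))
    simpa [hk] using this
  obtain ⟨ε, hε, hε2⟩ := Metric.mem_nhds_iff.1 hball
  refine ⟨ε⁻¹, fun w hw => ?_⟩
  by_contra hwR
  rw [mem_closedBall_zero_iff, not_le] at hwR
  have hw0 : w ≠ 0 := by
    rintro rfl; simp at hwR; linarith
  obtain ⟨v, hv, hvw⟩ := hε2 (show w⁻¹ ∈ ball 0 ε by
    rw [mem_ball_zero_iff, norm_inv]; exact inv_lt_of_inv_lt₀ hε hwR)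
  rw [mem_ball_zero_iff] at hv
  have hv0 : v ≠ 0 := by
    rintro rfl
    simp [hk] at hvw
    exact hw0 hvw.symm
  have hd0 : (r : ℂ) + v * G v ≠ 0 := by
    intro h
    simp only [hk, h, div_zero] at hvw
    exact hw0 (inv_eq_zero.1 hvw.symm)
  have hvn : ρ < ‖v⁻¹‖ := by
    rw [norm_inv]; exact lt_inv_of_lt_inv₀ (norm_pos_iff.2 hv0) hv
  refine hw ⟨v⁻¹, hvn, ?_⟩
  rw [hg.eq_add_tsum (hρ.trans_lt hvn), inv_inv]
  have h5 : w = (r + v * G v) / v := by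
    rw [← inv_inv w, ← hvw]; simp only [hk, inv_div]
  rw [h5]; simp only [hG]; field_simp

theorem measurableSet_image (hg : IsUnivalentAtInfinity g r c) {ρ : ℝ} (hρ : 1 ≤ ρ) :
    MeasurableSet (g '' {z | ρ < ‖z‖}) :=
  measurable_image_of_fderivWithin (measurable_norm_gt ρ)
    (fun _ hz => ((hg.hasDerivAt (hρ.trans_lt hz)).hasFDerivAt.restrictScalars ℝ).hasFDerivWithinAt)
    (hg.injOn.mono fun _ hz => hρ.trans_lt hz)

/-- Green's formula for the complement of the image of `{|z| > ρ}`. -/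
theorem integral_compl_image (hg : IsUnivalentAtInfinity g r c) {p q : ℂ → ℂ}
    (hp : Differentiable ℂ p) (hq : Differentiable ℂ q) {ρ : ℝ} (hρ : 1 < ρ) :
    2 * I * ∫ w in (g '' {z | ρ < ‖z‖})ᶜ, p w * conj (deriv q w) =
      ∮ z in C(0, ρ), deriv g z * (p (g z) * conj (q (g z))) := by
  obtain ⟨R₁, hR₁⟩ := hg.exists_compl_image_subset hρ.le
  have hsph : ContinuousOn g (sphere 0 ρ) := hg.differentiableOn.continuousOn.mono fun z hz => by
    simpa [mem_sphere_zero_iff_norm.1 hz] using hρ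
  obtain ⟨R₂, hR₂⟩ := (isCompact_sphere (0 : ℂ) ρ).exists_bound_of_continuousOn hsph
  set R := max (max R₁ R₂) 0 + 1 with hR
  have hRpos : 0 < R := by positivity
  have hRR₁ : R₁ < R := by
    have h1 := le_max_left R₁ R₂
    have h2 := le_max_left (max R₁ R₂) 0
    linarith
  have hRR₂ : R₂ < R := by
    have h1 := le_max_right R₁ R₂
    have h2 := le_max_left (max R₁ R₂) 0
    linarith
  -- The cutoff is `1` on a disc containing both the complement of the image and the curve `g(|z| =
  -- ρ)`, so it affects neither side of the formula.
  let u : ContDiffBump (0 : ℂ) := ⟨R, R + 1, hRpos, by linarith⟩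
  set W : ℂ → ℂ := fun w => (u w : ℂ) * (p w * conj (q w)) with hWdef
  have hpc : ContDiff ℝ 1 p := (hp.contDiff (n := 1)).restrict_scalars ℝ
  have hqc : ContDiff ℝ 1 q := (hq.contDiff (n := 1)).restrict_scalars ℝ
  have hW : ContDiff ℝ 1 W :=
    (ofRealCLM.contDiff.comp u.contDiff).mul (hpc.mul (conjCLE.contDiff.comp hqc))
  have hWs : HasCompactSupport W := by
    refine HasCompactSupport.mul_right ?_
    exact u.hasCompactSupport.comp_left (g := fun x : ℝ => (x : ℂ)) ofReal_zero
  have hWin : ∀ w, ‖w‖ < R → W =ᶠ[𝓝 w] fun w => p w * conj (q w) := by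
    intro w hw
    filter_upwards [isOpen_ball.mem_nhds (mem_ball_zero_iff.2 hw)] with x hx
    have : u x = 1 := u.one_of_mem_closedBall (ball_subset_closedBall hx)
    simp [hWdef, this]
  have hWout : ∀ w, R + 1 ≤ ‖w‖ → W w = 0 := by
    intro w hw
    have : u w = 0 := u.zero_of_le_dist (by simpa using hw)
    simp [hWdef, this]
  have hdin : ∀ w ∈ (g '' {z | ρ < ‖z‖})ᶜ,
      dbar (fderiv ℝ W w) = 2 * I * (p w * conj (deriv q w)) := by
    intro w hw
    have hwR : ‖w‖ < R := (mem_closedBall_zero_iff.1 (hR₁ hw)).trans_lt hRR₁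
    rw [(hWin w hwR).fderiv_eq]
    have hq' : HasFDerivAt (fun w => conj (q w)) ((conjCLE : ℂ →L[ℝ] ℂ) ∘L
        ((ContinuousLinearMap.toSpanSingleton ℂ (deriv q w)).restrictScalars ℝ)) w :=
      conjCLE.hasFDerivAt.comp w ((hq w).hasDerivAt.hasFDerivAt.restrictScalars ℝ)
    have hp' := (hp w).hasDerivAt.hasFDerivAt.restrictScalars ℝ
    have h1 : fderiv ℝ (fun w => p w * conj (q w)) w = _ := (hp'.mul hq').fderiv
    rw [h1]
    erw [dbar_smul_holomorphic]
    rw [dbar_comp_holomorphic]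
    simp [dbar]; ring
  -- `V dz` is the pullback of `W dw` under `g`. Green's theorem is thus applied on round circles
  -- only, never along the image curve.
  set V : ℂ → ℂ := fun z => deriv g z * W (g z) with hVdef
  have hgc : ContDiffOn ℝ 1 g {z | 1 < ‖z‖} :=
    (hg.differentiableOn.contDiffOn (isOpen_norm_gt 1)).restrict_scalars ℝ
  have hg'd : DifferentiableOn ℂ (deriv g) {z | 1 < ‖z‖} :=
    hg.differentiableOn.deriv (isOpen_norm_gt 1)
  have hg'c : ContDiffOn ℝ 1 (deriv g) {z | 1 < ‖z‖} :=
    (hg'd.contDiffOn (isOpen_norm_gt 1)).restrict_scalars ℝ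
  have hV : ContDiffOn ℝ 1 V {z | 1 < ‖z‖} := hg'c.mul (hW.comp_contDiffOn hgc)
  have hVd : ∀ z, ρ < ‖z‖ → dbar (fderiv ℝ V z)
      = ((‖deriv g z‖ ^ 2 : ℝ) : ℂ) * dbar (fderiv ℝ W (g z)) := by
    intro z hz
    have hz1 : 1 < ‖z‖ := hρ.trans hz
    have h1 := (hg.hasDerivAt hz1).hasFDerivAt.restrictScalars ℝ
    have h2 := (hg'd.differentiableAt
      ((isOpen_norm_gt 1).mem_nhds hz1)).hasDerivAt.hasFDerivAt.restrictScalars ℝ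
    have h3 := ((hW.differentiable one_ne_zero (g z)).hasFDerivAt).comp z h1
    have h4 := HasFDerivAt.fderiv (h2.mul h3)
    have h5 : fderiv ℝ V z = _ := h4
    rw [h5]
    erw [dbar_smul_holomorphic]
    rw [dbar_comp_holomorphic, ← mul_assoc, mul_conj, normSq_eq_norm_sq]
  obtain ⟨S, hS, hSg⟩ := hg.exists_norm_ge (R + 1)
  have hgreen := integral_dbar_exterior_circle hV hρ (S := max S (ρ + 1))
    (by simp) (fun z hz => by
      simp [hVdef, hWout _ (hSg z ((le_max_left _ _).trans hz))])
  have hint : Integrable (fun w => dbar (fderiv ℝ W w)) := by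
    refine (continuous_dbar.comp (hW.continuous_fderiv one_ne_zero)).integrable_of_hasCompactSupport ?_
    exact (hWs.fderiv ℝ).comp_left (g := dbar) (by simp [dbar])
  have hzero := integral_dbar_eq_zero hW hWs
  -- The integral of `dbar W` over the plane is zero. Its part over the image is minus the circle
  -- integral, so its part over the complement is the circle integral.
  rw [← integral_add_compl (hg.measurableSet_image hρ.le) hint,
    integral_image_holomorphic (measurable_norm_gt ρ) (fun z hz => hg.hasDerivAt (hρ.trans hz))
      (hg.injOn.mono fun z hz => hρ.trans hz),
    ← setIntegral_congr_fun (measurable_norm_gt ρ) hVd, hgreen,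
    setIntegral_congr_fun (hg.measurableSet_image hρ.le).compl hdin, integral_const_mul] at hzero
  rw [neg_add_eq_zero] at hzero
  rw [← hzero]
  refine circleIntegral.integral_congr (by linarith) fun z hz => ?_
  have : ‖g z‖ < R := (hR₂ z hz).trans_lt hRR₂
  simp only [hVdef, (hWin _ this).eq_of_nhds]

end IsUnivalentAtInfinity

end ExteriorMap

/-! ### Parseval's identity on the circle. -/

section Parseval

open Complex Set
open scoped Real ComplexConjugate

theorem integral_exp_int_mul (k : ℤ) :
    ∫ θ in (0 : ℝ)..2 * π, cexp (k * θ * I) = if k = 0 then 2 * π else 0 := by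
  split_ifs with h
  · simp [h]
  · have hk : (k : ℂ) * I ≠ 0 := by simp [h]
    have h1 := integral_exp_mul_complex (a := 0) (b := 2 * π) hk
    have h2 : ∀ θ : ℝ, (k : ℂ) * θ * I = k * I * θ := fun θ => by ring
    simp_rw [h2, h1]
    have h3 : cexp (k * I * ((2 * π : ℝ) : ℂ)) = 1 := by
      rw [← Complex.exp_int_mul_two_pi_mul_I k]; congr 1; push_cast; ring
    rw [h3]; simp

/-- Parseval's identity for absolutely convergent trigonometric series. -/
theorem hasSum_mul_conj_of_fourier {p q : ℤ → ℂ} (hp : Summable fun n => ‖p n‖)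
    (hq : Summable fun n => ‖q n‖) {P Q : ℝ → ℂ}
    (hP : ∀ θ : ℝ, HasSum (fun n : ℤ => p n * cexp (n * θ * I)) (P θ))
    (hQ : ∀ θ : ℝ, HasSum (fun n : ℤ => q n * cexp (n * θ * I)) (Q θ)) :
    HasSum (fun n => 2 * π * (p n * conj (q n))) (∫ θ in (0 : ℝ)..2 * π, P θ * conj (Q θ)) := by
  have hn : ∀ (n : ℤ) (θ : ℝ), ‖cexp (n * θ * I)‖ = 1 := fun n θ => by
    rw [← ofReal_intCast, ← ofReal_mul]; exact norm_exp_ofReal_mul_I _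
  have hb : Summable fun x : ℤ × ℤ => ‖p x.1‖ * ‖q x.2‖ :=
    hp.mul_of_nonneg hq (fun _ => norm_nonneg _) (fun _ => norm_nonneg _)
  have hterm : ∀ (x : ℤ × ℤ) (θ : ℝ), p x.1 * cexp (x.1 * θ * I) *
      conj (q x.2 * cexp (x.2 * θ * I)) =
      p x.1 * conj (q x.2) * cexp (((x.1 - x.2 : ℤ) : ℂ) * θ * I) := by
    intro x θ
    have : cexp (((x.1 - x.2 : ℤ) : ℂ) * θ * I) = cexp (x.1 * θ * I) * cexp (-(x.2 * θ * I)) := by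
      rw [← Complex.exp_add]; congr 1; push_cast; ring
    rw [this, map_mul, ← exp_conj]
    simp only [map_mul, conj_I, conj_ofReal, map_intCast, mul_neg]
    ring
  have hsum : ∀ θ : ℝ, HasSum (fun x : ℤ × ℤ => p x.1 * conj (q x.2) *
      cexp (((x.1 - x.2 : ℤ) : ℂ) * θ * I)) (P θ * conj (Q θ)) := by
    intro θ
    have h2 : HasSum (fun n : ℤ => conj (q n * cexp (n * θ * I))) (conj (Q θ)) :=
      hasSum_conj'.2 (hQ θ)
    have h3 : Summable fun x : ℤ × ℤ => p x.1 * cexp (x.1 * θ * I) *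
        conj (q x.2 * cexp (x.2 * θ * I)) := by
      refine Summable.of_norm (hb.congr fun x => ?_)
      rw [norm_mul, RCLike.norm_conj, norm_mul, norm_mul, hn, hn, mul_one, mul_one]
    exact (HasSum.mul (hP θ) h2 h3).congr_fun fun x => (hterm x θ).symm
  have hmeas : ∀ x : ℤ × ℤ, AEStronglyMeasurable (fun θ : ℝ => p x.1 * conj (q x.2) *
      cexp (((x.1 - x.2 : ℤ) : ℂ) * θ * I)) (volume.restrict (uIoc (0 : ℝ) (2 * π))) := fun x =>
    Continuous.aestronglyMeasurable (by fun_prop)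
  have hbound : ∀ (x : ℤ × ℤ) (θ : ℝ), ‖p x.1 * conj (q x.2) *
      cexp (((x.1 - x.2 : ℤ) : ℂ) * θ * I)‖ ≤ ‖p x.1‖ * ‖q x.2‖ := fun x θ => by
    rw [norm_mul, hn, norm_mul, RCLike.norm_conj, mul_one]
  have key := intervalIntegral.hasSum_integral_of_dominated_convergence
    (fun (x : ℤ × ℤ) (_ : ℝ) => ‖p x.1‖ * ‖q x.2‖) hmeas
    (fun x => Filter.Eventually.of_forall fun θ _ => hbound x θ)
    (Filter.Eventually.of_forall fun _ _ => hb) intervalIntegrable_const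
    (Filter.Eventually.of_forall fun θ _ => hsum θ)
  have hinj : Function.Injective fun n : ℤ => (n, n) := fun a b h => (Prod.mk.inj h).1
  rw [← hinj.hasSum_iff] at key
  · refine key.congr_fun fun n => ?_
    rw [Function.comp_apply, intervalIntegral.integral_const_mul, integral_exp_int_mul,
      if_pos (sub_self n)]
    push_cast; ring
  · rintro ⟨m, n⟩ hmn
    have hmn' : m - n ≠ 0 := fun h => hmn ⟨m, by simp [show n = m by omega]⟩
    rw [intervalIntegral.integral_const_mul, integral_exp_int_mul, if_neg hmn', ofReal_zero, mul_zero]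

end Parseval

/-! ### Faber polynomials and their composition with the map. -/

section Faber

open Complex Set Metric
open scoped Real Topology ComplexConjugate

/-- The Faber polynomials of `g z = r z + c₀ + c₁ / z + ⋯`. -/
noncomputable def faber (r : ℝ) (c : ℕ → ℂ) : ℕ → Polynomial ℂ
  | 0 => 1
  | k + 1 => Polynomial.C ((r : ℂ)⁻¹) * (Polynomial.X * faber r c k
      - ∑ j : Fin (k + 1), Polynomial.C (c j) * faber r c (k - j) - Polynomial.C (k * c k))

theorem faber_zero (r : ℝ) (c : ℕ → ℂ) : faber r c 0 = 1 := by rw [faber]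

theorem faber_succ (r : ℝ) (c : ℕ → ℂ) (k : ℕ) :
    faber r c (k + 1) = Polynomial.C ((r : ℂ)⁻¹) * (Polynomial.X * faber r c k
      - ∑ j ∈ Finset.range (k + 1), Polynomial.C (c j) * faber r c (k - j)
      - Polynomial.C (k * c k)) := by
  rw [faber, Finset.sum_range]

theorem natDegree_faber_le (r : ℝ) (c : ℕ → ℂ) (m : ℕ) : (faber r c m).natDegree ≤ m := by
  induction m using Nat.strong_induction_on with
  | _ m ih =>
    rcases m with _ | k
    · simp [faber_zero]
    · rw [faber_succ]
      refine (Polynomial.natDegree_C_mul_le _ _).trans ?_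
      refine (Polynomial.natDegree_sub_le _ _).trans (max_le
        ((Polynomial.natDegree_sub_le _ _).trans (max_le ?_ ?_))
        ((Polynomial.natDegree_C _).le.trans (Nat.zero_le _)))
      · refine Polynomial.natDegree_mul_le.trans ?_
        have := ih k (by omega)
        have := Polynomial.natDegree_X_le (R := ℂ)
        omega
      · refine Polynomial.natDegree_sum_le_of_forall_le _ _ fun j _ => ?_
        refine (Polynomial.natDegree_C_mul_le _ _).trans ?_
        have := ih (k - j) (by omega)
        omega

theorem coeff_faber_self (r : ℝ) (c : ℕ → ℂ) (m : ℕ) : (faber r c m).coeff m = (r : ℂ)⁻¹ ^ m := by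
  induction m with
  | zero => simp [faber_zero]
  | succ k ih =>
    rw [faber_succ, Polynomial.coeff_C_mul, Polynomial.coeff_sub, Polynomial.coeff_sub,
      Polynomial.coeff_X_mul, ih, Polynomial.finsetSum_coeff, Finset.sum_eq_zero, Polynomial.coeff_C,
      if_neg (by omega), sub_zero, sub_zero, pow_succ, mul_comm]
    intro j _
    rw [Polynomial.coeff_C_mul, Polynomial.coeff_eq_zero_of_natDegree_lt, mul_zero]
    have := natDegree_faber_le r c (k - j)
    omega

/-- The coefficient of `u ^ i`, `i ≥ 1`, of
`1 - (g (1 / u) - g (1 / v)) / (r (1 / u - 1 / v))`. -/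
noncomputable def kernelCoeff (r : ℝ) (c : ℕ → ℂ) (i : ℕ) (v : ℂ) : ℂ :=
  v / r * ∑' j, c (i + j) * v ^ j

/-- The part of negative degree of `faber m ∘ g`, as a function of `1 / z`. -/
noncomputable def faberTail (r : ℝ) (c : ℕ → ℂ) : ℕ → ℂ → ℂ
  | 0 => fun _ => 0
  | k + 1 => fun v => (k + 1) * kernelCoeff r c (k + 1) v
      + ∑ i : Fin k, kernelCoeff r c (i + 1) v * faberTail r c (k - i) v

theorem faberTail_zero (r : ℝ) (c : ℕ → ℂ) (v : ℂ) : faberTail r c 0 v = 0 := by rw [faberTail]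

theorem faberTail_succ (r : ℝ) (c : ℕ → ℂ) (k : ℕ) (v : ℂ) :
    faberTail r c (k + 1) v = (k + 1) * kernelCoeff r c (k + 1) v
      + ∑ i ∈ Finset.range k, kernelCoeff r c (i + 1) v * faberTail r c (k - i) v := by
  rw [faberTail, Finset.sum_range]

theorem faberTail_at_zero (r : ℝ) (c : ℕ → ℂ) (m : ℕ) : faberTail r c m 0 = 0 := by
  rcases m with _ | k
  · rw [faberTail_zero]
  · rw [faberTail_succ]; simp [kernelCoeff]

/-- The coefficients of `(g (1 / u) - g (1 / v)) / (r (1 / u - 1 / v))` as a power series in `u`. -/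
noncomputable def kernelSeries (r : ℝ) (c : ℕ → ℂ) (v : ℂ) (i : ℕ) : ℂ :=
  if i = 0 then 1 else -kernelCoeff r c i v

/-- Coefficientwise this is `Ψ T = -u Ψ'`, where `Ψ` and `T` are the generating series of
`kernelSeries` and `faberTail`: the tails are the coefficients of `-u (log Ψ)'`. -/
theorem sum_kernelSeries_mul_faberTail (r : ℝ) (c : ℕ → ℂ) (v : ℂ) (k : ℕ) :
    ∑ i ∈ Finset.range (k + 1), kernelSeries r c v i * faberTail r c (k - i) v =
      -(k * kernelSeries r c v k) := by
  rcases k with _ | k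
  · simp [faberTail_zero]
  rw [Finset.sum_range_succ', Finset.sum_range_succ]
  simp only [kernelSeries, if_true, Nat.sub_zero, faberTail_succ]
  rw [Nat.sub_self, faberTail_zero]
  have : ∀ i ∈ Finset.range k, (if i + 1 = 0 then (1 : ℂ) else -kernelCoeff r c (i + 1) v) *
      faberTail r c (k + 1 - (i + 1)) v =
      -(kernelCoeff r c (i + 1) v * faberTail r c (k - i) v) := by
    intro i _
    rw [if_neg (by omega), Nat.add_sub_add_right]; ring
  rw [Finset.sum_congr rfl this, Finset.sum_neg_distrib, if_neg (by omega)]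
  push_cast
  ring

namespace IsUnivalentAtInfinity

variable {g : ℂ → ℂ} {r : ℝ} {c : ℕ → ℂ}

theorem summable_shift (hg : IsUnivalentAtInfinity g r c) (i : ℕ) (v : ℂ) (hv : ‖v‖ < 1) :
    Summable fun j => c (i + j) * v ^ j := by
  by_cases h : v = 0
  · subst h
    exact summable_of_ne_finset_zero (s := {0}) fun k hk => by
      simp [show k ≠ 0 by simpa using hk]
  · have h1 := (summable_nat_add_iff i).2 (hg.summable v hv)
    refine (h1.mul_left ((v ^ i)⁻¹)).congr fun j => ?_
    rw [add_comm j i, pow_add]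
    field_simp

theorem differentiableOn_kernelCoeff (hg : IsUnivalentAtInfinity g r c) (i : ℕ) :
    DifferentiableOn ℂ (kernelCoeff r c i) (ball 0 1) :=
  (differentiableOn_id.div_const _).mul (differentiableOn_powerSeries (hg.summable_shift i))

theorem differentiableOn_faberTail (hg : IsUnivalentAtInfinity g r c) (m : ℕ) :
    DifferentiableOn ℂ (faberTail r c m) (ball 0 1) := by
  induction m using Nat.strong_induction_on with
  | _ m ih =>
    rcases m with _ | k
    · rw [faberTail]; fun_prop
    · rw [faberTail]
      refine ((hg.differentiableOn_kernelCoeff _).const_mul _).add ?_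
      exact DifferentiableOn.fun_sum fun i _ =>
        (hg.differentiableOn_kernelCoeff _).mul (ih _ (by omega))

theorem kernelCoeff_succ (hg : IsUnivalentAtInfinity g r c) (k : ℕ) {z : ℂ} (hz : 1 < ‖z‖) :
    kernelCoeff r c (k + 1) z⁻¹ = z * kernelCoeff r c k z⁻¹ - c k / r := by
  have hz0 : z ≠ 0 := by rintro rfl; simp at hz; linarith
  have hr : (r : ℂ) ≠ 0 := by exact_mod_cast hg.pos.ne'
  have hv : ‖z⁻¹‖ < 1 := by rw [norm_inv]; exact inv_lt_one_of_one_lt₀ hz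
  unfold kernelCoeff
  rw [(hg.summable_shift k z⁻¹ hv).tsum_eq_zero_add]
  have : ∀ j, c (k + (j + 1)) * z⁻¹ ^ (j + 1) = z⁻¹ * (c (k + 1 + j) * z⁻¹ ^ j) := fun j => by
    rw [show k + (j + 1) = k + 1 + j by ring, pow_succ]; ring
  simp_rw [this, tsum_mul_left]
  field_simp
  simp

theorem kernelCoeff_zero (hg : IsUnivalentAtInfinity g r c) {z : ℂ} (hz : 1 < ‖z‖) :
    z * kernelCoeff r c 0 z⁻¹ = g z / r - z := by
  have hz0 : z ≠ 0 := by rintro rfl; simp at hz; linarith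
  have hr : (r : ℂ) ≠ 0 := by exact_mod_cast hg.pos.ne'
  rw [hg.eq_add_tsum hz]
  unfold kernelCoeff
  simp only [zero_add]
  field_simp
  ring

/-- Multiplying the difference quotient by `1 - z u` clears its denominator and leaves `u (g(1/u) -
g(z)) / r`; this is that identity on coefficients. -/
theorem kernelSeries_succ (hg : IsUnivalentAtInfinity g r c) (k : ℕ) {z : ℂ} (hz : 1 < ‖z‖) :
    kernelSeries r c z⁻¹ (k + 1) - z * kernelSeries r c z⁻¹ k =
      (c k - if k = 0 then g z else 0) / r := by
  rw [kernelSeries, kernelSeries, if_neg (by omega), hg.kernelCoeff_succ k hz]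
  split_ifs with h
  · subst h; rw [hg.kernelCoeff_zero hz]; ring
  · ring

open PowerSeries in
/-- The composition of a Faber polynomial with `g`. -/
theorem eval_faber (hg : IsUnivalentAtInfinity g r c) (m : ℕ) {z : ℂ} (hz : 1 < ‖z‖) :
    (faber r c m).eval (g z) = z ^ m + faberTail r c m z⁻¹ := by
  have hr : (r : ℂ) ≠ 0 := by exact_mod_cast hg.pos.ne'
  set Ψ : PowerSeries ℂ := PowerSeries.mk (kernelSeries r c z⁻¹) with hΨ
  set T : PowerSeries ℂ := PowerSeries.mk fun i => faberTail r c i z⁻¹ with hT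
  set Φ : PowerSeries ℂ := PowerSeries.mk fun i => (faber r c i).eval (g z) with hΦ
  set Q : PowerSeries ℂ := PowerSeries.mk fun i => z ^ i with hQ
  -- `Y` is the series of `u (g(1/u) - g(z)) / r`, and `Q` below is inverse to `1 - z X`.
  set Y : PowerSeries ℂ := (1 - PowerSeries.C z * X) * Ψ with hY
  have hQ1 : (1 - PowerSeries.C z * X) * Q = 1 := by
    ext k
    rw [sub_mul, one_mul, mul_assoc, map_sub, coeff_C_mul]
    rcases k with _ | k
    · simp [hQ]
    · rw [coeff_succ_X_mul]; simp [hQ, pow_succ, mul_comm, coeff_one]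
  have hYc : ∀ k, coeff (k + 1) Y = (c k - if k = 0 then g z else 0) / r := by
    intro k
    rw [hY, sub_mul, one_mul, mul_assoc, map_sub, coeff_C_mul, coeff_succ_X_mul, hΨ, coeff_mk,
      coeff_mk, hg.kernelSeries_succ k hz]
  have hY0 : coeff 0 Y = 1 := by simp [hY, hΨ, kernelSeries]
  have hT1 : Ψ * T = -(X * d⁄dX ℂ Ψ) := by
    ext k
    rw [coeff_mul, Finset.Nat.sum_antidiagonal_eq_sum_range_succ_mk]
    simp only [hΨ, hT, coeff_mk, sum_kernelSeries_mul_faberTail]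
    rcases k with _ | k
    · simp
    · rw [map_neg, coeff_succ_X_mul, coeff_derivative, coeff_mk]
      push_cast
      ring
  -- On coefficients this is the Faber recursion. It says `Φ = 1 - u (log Y)'`, while `log Y = log(1
  -- - z u) + log Ψ`; the two logarithms contribute `Q` and `T`.
  have hΦ1 : Y * Φ = Y - X * d⁄dX ℂ Y := by
    ext k
    rw [coeff_mul]
    rcases k with _ | k
    · have h1 : constantCoeff Y = 1 := by simpa using hY0
      simp [hΦ, faber_zero, h1]
    rw [map_sub, coeff_succ_X_mul, coeff_derivative, Finset.Nat.sum_antidiagonal_eq_sum_range_succ_mk,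
      Finset.sum_range_succ', hY0]
    simp only [hYc, hΦ, coeff_mk, Nat.sub_zero, Nat.add_sub_add_right, faber_succ]
    simp only [Polynomial.eval_mul, Polynomial.eval_sub, Polynomial.eval_C, Polynomial.eval_X,
      Polynomial.eval_finsetSum]
    have h1 : ∑ j ∈ Finset.range (k + 1), (c j - if j = 0 then g z else 0) / r *
        (faber r c (k - j)).eval (g z) = (r : ℂ)⁻¹ * (∑ j ∈ Finset.range (k + 1), c j *
        (faber r c (k - j)).eval (g z)) - (r : ℂ)⁻¹ * (g z * (faber r c k).eval (g z)) := by
      rw [← mul_sub, Finset.sum_range_succ', Finset.sum_range_succ' _ k]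
      simp only [Nat.add_eq_zero_iff, one_ne_zero, and_false, if_false, sub_zero, if_true]
      rw [add_sub_assoc, mul_add, Finset.mul_sum]
      congr 1
      · exact Finset.sum_congr rfl fun i _ => by ring
      · simp only [Nat.sub_zero]; ring
    rw [h1]
    split_ifs with h
    · subst h; simp; ring
    · ring
  have hYne : Y ≠ 0 := fun h => by simp [h] at hY0
  have hfin : Φ = Q + T := by
    refine mul_left_cancel₀ hYne ?_
    have hd : d⁄dX ℂ Y = (1 - PowerSeries.C z * X) * d⁄dX ℂ Ψ - PowerSeries.C z * Ψ := by
      rw [hY, Derivation.leibniz, map_sub, Derivation.leibniz, derivative_X, derivative_C,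
        Derivation.map_one_eq_zero]
      simp only [smul_eq_mul]
      ring
    have hYQ : Y * Q = Ψ := by
      rw [hY, mul_right_comm, hQ1, one_mul]
    rw [hΦ1, hd, mul_add, hYQ]
    rw [show Y * T = (1 - PowerSeries.C z * X) * (Ψ * T) by rw [hY]; ring, hT1]
    rw [hY]; ring
  have := congrArg (coeff m) hfin
  simpa [hΦ, hQ, hT] using this

end IsUnivalentAtInfinity

end Faber

/-! ### Gram matrix of the Faber derivatives outside a level curve. -/

section Gram

open Complex Set Metric Filter
open scoped Real Topology ComplexConjugate

/-- The coefficient of `z ^ (-(n + 1))` of `faber m ∘ g`. -/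
noncomputable def faberCoeff (r : ℝ) (c : ℕ → ℂ) (m n : ℕ) : ℂ :=
  iteratedDeriv (n + 1) (faberTail r c m) 0 / (n + 1).factorial

theorem hasSum_int_of_nat {f g : ℕ → ℂ} {F : ℤ → ℂ} {a b : ℂ} (hf : HasSum f a) (hg : HasSum g b)
    (h1 : ∀ n : ℕ, F n = f n) (h2 : ∀ n : ℕ, F (Int.negSucc n) = g n) : HasSum F (a + b) := by
  have h := HasSum.int_rec hf hg
  refine h.congr_fun fun n => ?_
  cases n with
  | ofNat n => exact h1 n
  | negSucc n => exact h2 n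

/-- Coefficients indexed by `ℤ`: `x` at `j ≥ 0` and `y n` at `-(n + 1)`. -/
def laurentCoeff (j : ℕ) (x : ℂ) (y : ℕ → ℂ) : ℤ → ℂ
  | Int.ofNat n => if n = j then x else 0
  | Int.negSucc n => y n

theorem summable_norm_laurentCoeff (j : ℕ) (x : ℂ) {y : ℕ → ℂ} (hy : Summable fun n => ‖y n‖) :
    Summable fun n => ‖laurentCoeff j x y n‖ := by
  have h1 : HasSum (fun n : ℕ => if n = j then ‖x‖ else 0) ‖x‖ := hasSum_ite_eq j _
  have h := HasSum.int_rec h1 hy.hasSum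
  refine h.summable.congr fun n => ?_
  cases n with
  | ofNat n => simp only [laurentCoeff]; split_ifs <;> simp
  | negSucc n => rfl

theorem hasSum_laurent {j : ℕ} {x : ℂ} {y : ℕ → ℂ} {ρ θ : ℝ} {s : ℂ}
    (hs : HasSum (fun n => y n * (circleMap 0 ρ θ)⁻¹ ^ (n + 1)) s) :
    HasSum (fun n : ℤ => laurentCoeff j (x * (ρ : ℂ) ^ j) (fun n => y n * (ρ : ℂ)⁻¹ ^ (n + 1)) n *
      cexp (n * θ * I)) (x * circleMap 0 ρ θ ^ j + s) := by
  refine hasSum_int_of_nat (f := fun n => if n = j then x * circleMap 0 ρ θ ^ j else 0)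
    (hasSum_ite_eq j _) hs (fun n => ?_) (fun n => ?_)
  · change (if n = j then _ else _) * _ = _
    split_ifs with h
    · subst h
      rw [circleMap_zero, mul_pow, ← Complex.exp_nat_mul]
      push_cast
      ring_nf
    · simp
  · change y n * (ρ : ℂ)⁻¹ ^ (n + 1) * _ = _
    rw [circleMap_zero, mul_inv, mul_pow, ← Complex.exp_neg, ← Complex.exp_nat_mul, mul_assoc]
    congr 3
    push_cast
    ring

namespace IsUnivalentAtInfinity

variable {g : ℂ → ℂ} {r : ℝ} {c : ℕ → ℂ}

theorem hasSum_faberTail (hg : IsUnivalentAtInfinity g r c) (m : ℕ) {v : ℂ} (hv : ‖v‖ < 1) :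
    HasSum (fun n => faberCoeff r c m n * v ^ (n + 1)) (faberTail r c m v) := by
  have := (hasSum_nat_add_iff' 1).2 (hasSum_taylor_ball (hg.differentiableOn_faberTail m) hv)
  simpa [faberTail_at_zero, faberCoeff] using this

theorem summable_faberCoeff (hg : IsUnivalentAtInfinity g r c) (m : ℕ) {v : ℂ} (hv : ‖v‖ < 1) :
    Summable fun n => ‖((n + 1 : ℕ) : ℂ) * faberCoeff r c m n * v ^ (n + 1)‖ := by
  have := (summable_nat_add_iff 1).2
    (summable_norm_deriv_powerSeries (fun v hv => (hasSum_taylor_ball (hg.differentiableOn_faberTail m) hv).summable) hv)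
  refine (this.mul_left ‖v‖).congr fun n => ?_
  rw [← norm_mul, faberCoeff, pow_succ]
  congr 1
  simp only [add_tsub_cancel_right]
  ring

theorem hasSum_deriv_faberTail (hg : IsUnivalentAtInfinity g r c) (m : ℕ) {v : ℂ} (hv : ‖v‖ < 1) :
    HasSum (fun n => ((n + 1 : ℕ) : ℂ) * faberCoeff r c m n * v ^ (n + 1))
      (v * deriv (faberTail r c m) v) := by
  have hs : ∀ v : ℂ, ‖v‖ < 1 →
      Summable fun n => (iteratedDeriv n (faberTail r c m) 0 / n.factorial) * v ^ n :=
    fun v hv => (hasSum_taylor_ball (hg.differentiableOn_faberTail m) hv).summable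
  have h1 := (hasDerivAt_powerSeries hs hv).deriv
  have h2 : deriv (faberTail r c m) v = deriv
      (fun v => ∑' n, (iteratedDeriv n (faberTail r c m) 0 / n.factorial) * v ^ n) v := by
    apply Filter.EventuallyEq.deriv_eq
    filter_upwards [isOpen_ball.mem_nhds (mem_ball_zero_iff.2 hv)] with w hw
    rw [(hasSum_taylor_ball (hg.differentiableOn_faberTail m) (mem_ball_zero_iff.1 hw)).tsum_eq]
  rw [h2, h1]
  have h3 := (summable_norm_deriv_powerSeries hs hv).of_norm.hasSum
  have h4 := (hasSum_nat_add_iff' 1).2 h3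
  simp only [Finset.range_one, Finset.sum_singleton, Nat.cast_zero, zero_mul, sub_zero] at h4
  refine (h4.mul_left v).congr_fun fun n => ?_
  rw [faberCoeff, pow_succ]
  simp only [add_tsub_cancel_right]
  ring

theorem hasDerivAt_eval_faber (hg : IsUnivalentAtInfinity g r c) (m : ℕ) {z : ℂ} (hz : 1 < ‖z‖) :
    z * (deriv g z * (faber r c m).derivative.eval (g z)) =
      m * z ^ m + -(z⁻¹ * deriv (faberTail r c m) z⁻¹) := by
  have hz0 : z ≠ 0 := by rintro rfl; simp at hz; linarith
  have hv : ‖z⁻¹‖ < 1 := by rw [norm_inv]; exact inv_lt_one_of_one_lt₀ hz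
  have h1 : HasDerivAt (fun z => (faber r c m).eval (g z))
      ((faber r c m).derivative.eval (g z) * deriv g z) z :=
    ((faber r c m).hasDerivAt (g z)).comp z (hg.hasDerivAt hz)
  have h2 : HasDerivAt (fun z => z ^ m + faberTail r c m z⁻¹)
      (m * z ^ (m - 1) + deriv (faberTail r c m) z⁻¹ * (-(z ^ 2)⁻¹)) z := by
    refine (hasDerivAt_pow m z).add ?_
    exact (((hg.differentiableOn_faberTail m).differentiableAt
      (isOpen_ball.mem_nhds (mem_ball_zero_iff.2 hv))).hasDerivAt).comp z (hasDerivAt_inv hz0)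
  have h3 : (fun z => (faber r c m).eval (g z)) =ᶠ[𝓝 z] fun z => z ^ m + faberTail r c m z⁻¹ := by
    filter_upwards [(isOpen_norm_gt 1).mem_nhds hz] with w hw using hg.eval_faber m hw
  have h4 := (h2.congr_of_eventuallyEq h3).unique h1
  rw [mul_comm (deriv g z), ← h4]
  rcases m with _ | m
  · simp; field_simp
  · simp only [Nat.add_sub_cancel]; field_simp; ring

/-- The Gram matrix of the derivatives of the Faber polynomials, outside `g {|z| > ρ}`. -/
theorem hasSum_gram_radius (hg : IsUnivalentAtInfinity g r c) (j k : ℕ) {ρ : ℝ} (hρ : 1 < ρ) :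
    HasSum (fun n : ℕ => ((n + 1 : ℕ) : ℂ) * faberCoeff r c j n * conj (faberCoeff r c k n) *
        ((ρ⁻¹ ^ (2 * (n + 1)) : ℝ) : ℂ))
      ((if j = k then (j * ρ ^ (2 * j) : ℂ) else 0) - (π : ℂ)⁻¹ * ∫ w in (g '' {z | ρ < ‖z‖})ᶜ,
        (faber r c j).derivative.eval w * conj ((faber r c k).derivative.eval w)) := by
  have hv : ‖(ρ : ℂ)⁻¹‖ < 1 := by
    rw [norm_inv, norm_real, Real.norm_of_nonneg (by positivity)]
    exact inv_lt_one_of_one_lt₀ hρ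
  have hcn : ∀ θ, ‖circleMap 0 ρ θ‖ = ρ := fun θ => by
    rw [norm_circleMap_zero, abs_of_pos (by positivity)]
  have hcv : ∀ θ, ‖(circleMap 0 ρ θ)⁻¹‖ < 1 := fun θ => by
    rw [norm_inv, hcn]; exact inv_lt_one_of_one_lt₀ hρ
  -- The sign and the factor `n + 1` come from applying `z d/dz` to `z ^ (-(n + 1))`.
  set y : ℕ → ℂ := fun n => -(((n + 1 : ℕ) : ℂ) * faberCoeff r c j n) with hy
  set x : ℕ → ℂ := fun n => faberCoeff r c k n with hx
  have hys : Summable fun n => ‖y n * (ρ : ℂ)⁻¹ ^ (n + 1)‖ := by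
    refine (hg.summable_faberCoeff j hv).congr fun n => ?_
    rw [hy, neg_mul, norm_neg]
  have hxs : Summable fun n => ‖x n * (ρ : ℂ)⁻¹ ^ (n + 1)‖ := by
    refine Summable.of_nonneg_of_le (fun n => norm_nonneg _) (fun n => ?_)
      (hg.summable_faberCoeff k hv)
    rw [mul_assoc, norm_mul _ (x n * _)]
    refine le_mul_of_one_le_left (norm_nonneg _) ?_
    rw [Complex.norm_natCast]; simp
  have hP : ∀ θ : ℝ, HasSum (fun n : ℤ => laurentCoeff j (j * (ρ : ℂ) ^ j)
      (fun n => y n * (ρ : ℂ)⁻¹ ^ (n + 1)) n * cexp (n * θ * I))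
      (circleMap 0 ρ θ * (deriv g (circleMap 0 ρ θ) *
        (faber r c j).derivative.eval (g (circleMap 0 ρ θ)))) := by
    intro θ
    rw [hg.hasDerivAt_eval_faber j (by rw [hcn]; exact hρ)]
    refine hasSum_laurent ?_
    refine (hg.hasSum_deriv_faberTail j (hcv θ)).neg.congr_fun fun n => ?_
    rw [hy]; ring
  have hQ : ∀ θ : ℝ, HasSum (fun n : ℤ => laurentCoeff k ((ρ : ℂ) ^ k)
      (fun n => x n * (ρ : ℂ)⁻¹ ^ (n + 1)) n * cexp (n * θ * I))
      ((faber r c k).eval (g (circleMap 0 ρ θ))) := by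
    intro θ
    rw [hg.eval_faber k (by rw [hcn]; exact hρ)]
    have := hasSum_laurent (j := k) (x := 1) (hg.hasSum_faberTail k (hcv θ))
    simpa only [one_mul] using this
  have hpars := hasSum_mul_conj_of_fourier (summable_norm_laurentCoeff j _ hys)
    (summable_norm_laurentCoeff k _ hxs) hP hQ
  -- With `p = F_j'` and `q = F_k`, the circle integrand is `z d/dz` of `F_j ∘ g` times the
  -- conjugate of `F_k ∘ g`, both with explicit Laurent series.
  have hgreen := hg.integral_compl_image (p := fun w => (faber r c j).derivative.eval w)
    (q := fun w => (faber r c k).eval w) (Polynomial.differentiable _)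
    (Polynomial.differentiable _) hρ
  have hcirc : (∮ z in C(0, ρ), deriv g z *
      ((faber r c j).derivative.eval (g z) * conj ((faber r c k).eval (g z)))) =
      I * ∫ θ in (0 : ℝ)..2 * π, (circleMap 0 ρ θ * (deriv g (circleMap 0 ρ θ) *
        (faber r c j).derivative.eval (g (circleMap 0 ρ θ)))) *
          conj ((faber r c k).eval (g (circleMap 0 ρ θ))) := by
    rw [circleIntegral, ← intervalIntegral.integral_const_mul]
    refine intervalIntegral.integral_congr fun θ _ => ?_
    simp only [deriv_circleMap, smul_eq_mul]; ring
  simp only [Polynomial.deriv] at hgreen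
  rw [hcirc] at hgreen
  set J := ∫ w in (g '' {z | ρ < ‖z‖})ᶜ,
        (faber r c j).derivative.eval w * conj ((faber r c k).derivative.eval w) with hJ
  have hJ2 : (∫ θ in (0 : ℝ)..2 * π, (circleMap 0 ρ θ * (deriv g (circleMap 0 ρ θ) *
        (faber r c j).derivative.eval (g (circleMap 0 ρ θ)))) *
          conj ((faber r c k).eval (g (circleMap 0 ρ θ)))) = 2 * J := by
    refine mul_left_cancel₀ I_ne_zero ?_
    rw [← hgreen]; ring
  rw [hJ2] at hpars
  have hpi : (π : ℂ) ≠ 0 := by exact_mod_cast Real.pi_ne_zero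
  have hsum : HasSum (fun n : ℤ => laurentCoeff j (j * (ρ : ℂ) ^ j)
      (fun n => y n * (ρ : ℂ)⁻¹ ^ (n + 1)) n * conj (laurentCoeff k ((ρ : ℂ) ^ k)
      (fun n => x n * (ρ : ℂ)⁻¹ ^ (n + 1)) n)) ((π : ℂ)⁻¹ * J) := by
    have := hpars.mul_left ((2 * π : ℂ)⁻¹)
    rw [show (2 * π : ℂ)⁻¹ * (2 * J) = (π : ℂ)⁻¹ * J by field_simp] at this
    refine this.congr_fun fun n => ?_
    field_simp
  have hneg : Summable fun n : ℕ => y n * (ρ : ℂ)⁻¹ ^ (n + 1) * conj (x n * (ρ : ℂ)⁻¹ ^ (n + 1)) :=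
    hsum.summable.comp_injective (i := Int.negSucc) fun a b h => Int.negSucc.inj h
  have hnat : HasSum (fun n : ℕ => (if n = j then (j * (ρ : ℂ) ^ j) else 0) *
      conj (if n = k then (ρ : ℂ) ^ k else 0)) (if j = k then (j * ρ ^ (2 * j) : ℂ) else 0) := by
    have := hasSum_ite_eq j (if j = k then (j * ρ ^ (2 * j) : ℂ) else 0)
    refine this.congr_fun fun n => ?_
    by_cases h1 : n = j
    · subst h1
      by_cases h2 : n = k
      · subst h2; simp; ring
      · simp [h2]
    · simp [h1]
  have huniq := hsum.unique (hasSum_int_of_nat hnat hneg.hasSum (fun n => rfl) (fun n => rfl))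
  have hfin := hneg.hasSum.neg
  have : -∑' n : ℕ, y n * (ρ : ℂ)⁻¹ ^ (n + 1) * conj (x n * (ρ : ℂ)⁻¹ ^ (n + 1)) =
      (if j = k then (j * ρ ^ (2 * j) : ℂ) else 0) - (π : ℂ)⁻¹ * J := by
    rw [huniq]; ring
  rw [this] at hfin
  refine hfin.congr_fun fun n => ?_
  simp only [hy, hx, map_mul, map_pow, map_inv₀, conj_ofReal]
  push_cast
  ring

end IsUnivalentAtInfinity

end Gram

/-! ### The limit `ρ → 1` and the area inequality. -/

section GramLimit

open Complex Set Metric Filter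
open scoped Real Topology ComplexConjugate

namespace IsUnivalentAtInfinity

variable {g : ℂ → ℂ} {r : ℝ} {c : ℕ → ℂ}

/-- This is the area theorem for `F_j ∘ g`: the diagonal Gram integral is nonnegative for every `ρ >
1`, and the finite sums pass to `ρ → 1`. -/
theorem sum_faberCoeff_le (hg : IsUnivalentAtInfinity g r c) (j N : ℕ) :
    ∑ n ∈ Finset.range N, ((n + 1 : ℕ) : ℝ) * ‖faberCoeff r c j n‖ ^ 2 ≤ j := by
  have h1 : ∀ ρ : ℝ, 1 < ρ → ∑ n ∈ Finset.range N, ((n + 1 : ℕ) : ℝ) * ‖faberCoeff r c j n‖ ^ 2 *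
      ρ⁻¹ ^ (2 * (n + 1)) ≤ j * ρ ^ (2 * j) := by
    intro ρ hρ
    have h := hg.hasSum_gram_radius j j hρ
    set J := ∫ w in (g '' {z | ρ < ‖z‖})ᶜ,
        (faber r c j).derivative.eval w * conj ((faber r c j).derivative.eval w) with hJ
    have hJr : J = ((∫ w in (g '' {z | ρ < ‖z‖})ᶜ, ‖(faber r c j).derivative.eval w‖ ^ 2 : ℝ) : ℂ) := by
      rw [hJ, ← integral_complex_ofReal]
      refine integral_congr_ae (Eventually.of_forall fun w => ?_)
      simp only [mul_conj, normSq_eq_norm_sq]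
    rw [if_pos rfl, hJr] at h
    have hre := hasSum_re h
    have h0 : 0 ≤ ∫ w in (g '' {z | ρ < ‖z‖})ᶜ, ‖(faber r c j).derivative.eval w‖ ^ 2 :=
      integral_nonneg fun w => by positivity
    have hterm : ∀ n : ℕ, (((n + 1 : ℕ) : ℂ) * faberCoeff r c j n * conj (faberCoeff r c j n) *
        ((ρ⁻¹ ^ (2 * (n + 1)) : ℝ) : ℂ)).re =
        ((n + 1 : ℕ) : ℝ) * ‖faberCoeff r c j n‖ ^ 2 * ρ⁻¹ ^ (2 * (n + 1)) := by
      intro n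
      rw [mul_assoc ((n + 1 : ℕ) : ℂ), mul_conj, normSq_eq_norm_sq, ← ofReal_natCast, ← ofReal_mul,
        ← ofReal_mul, ofReal_re]
    simp_rw [hterm] at hre
    refine (sum_le_hasSum _ (fun n _ => by positivity) hre).trans ?_
    have : ((j : ℂ) * (ρ : ℂ) ^ (2 * j) - (π : ℂ)⁻¹ * ((∫ w in (g '' {z | ρ < ‖z‖})ᶜ,
        ‖(faber r c j).derivative.eval w‖ ^ 2 : ℝ) : ℂ)).re = j * ρ ^ (2 * j) - π⁻¹ *
        ∫ w in (g '' {z | ρ < ‖z‖})ᶜ, ‖(faber r c j).derivative.eval w‖ ^ 2 := by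
      rw [← ofReal_natCast, ← ofReal_pow, ← ofReal_mul, ← ofReal_inv, ← ofReal_mul, ← ofReal_sub,
        ofReal_re]
    rw [this]
    have := mul_nonneg (inv_nonneg.2 Real.pi_pos.le) h0
    linarith
  have hL : Tendsto (fun ρ : ℝ => ∑ n ∈ Finset.range N, ((n + 1 : ℕ) : ℝ) *
      ‖faberCoeff r c j n‖ ^ 2 * ρ⁻¹ ^ (2 * (n + 1))) (𝓝[>] 1)
      (𝓝 (∑ n ∈ Finset.range N, ((n + 1 : ℕ) : ℝ) * ‖faberCoeff r c j n‖ ^ 2)) := by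
    have : ContinuousAt (fun ρ : ℝ => ∑ n ∈ Finset.range N, ((n + 1 : ℕ) : ℝ) *
      ‖faberCoeff r c j n‖ ^ 2 * ρ⁻¹ ^ (2 * (n + 1))) 1 := by fun_prop (disch := norm_num)
    have h2 := this.tendsto.mono_left (nhdsWithin_le_nhds (s := Ioi 1))
    simpa using h2
  have hR : Tendsto (fun ρ : ℝ => (j : ℝ) * ρ ^ (2 * j)) (𝓝[>] 1) (𝓝 j) := by
    have : ContinuousAt (fun ρ : ℝ => (j : ℝ) * ρ ^ (2 * j)) 1 := by fun_prop
    have h2 := this.tendsto.mono_left (nhdsWithin_le_nhds (s := Ioi 1))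
    simpa using h2
  exact le_of_tendsto_of_tendsto hL hR (by
    filter_upwards [self_mem_nhdsWithin] with ρ hρ using h1 ρ hρ)

theorem summable_faberCoeff_sq (hg : IsUnivalentAtInfinity g r c) (j : ℕ) :
    Summable fun n : ℕ => ((n + 1 : ℕ) : ℝ) * ‖faberCoeff r c j n‖ ^ 2 :=
  summable_of_sum_range_le (fun n => by positivity) (hg.sum_faberCoeff_le j)

/-- The Gram matrix of the derivatives of the Faber polynomials, outside `g {|z| > 1}`. -/
theorem gram_faber_compl (hg : IsUnivalentAtInfinity g r c) (j k : ℕ) :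
    ∫ w in (g '' {z | 1 < ‖z‖})ᶜ,
        (faber r c j).derivative.eval w * conj ((faber r c k).derivative.eval w) =
      π * ((if j = k then (j : ℂ) else 0) -
        ∑' n : ℕ, ((n + 1 : ℕ) : ℂ) * faberCoeff r c j n * conj (faberCoeff r c k n)) := by
  set F : ℂ → ℂ := fun w =>
    (faber r c j).derivative.eval w * conj ((faber r c k).derivative.eval w) with hF
  have hFc : Continuous F := by
    refine (Polynomial.continuous _).mul (continuous_conj.comp (Polynomial.continuous _))
  set ρ : ℕ → ℝ := fun N => 1 + 1 / ((N : ℝ) + 1) with hρdef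
  have hρ : ∀ N, 1 < ρ N := fun N => by
    have : 0 < 1 / ((N : ℝ) + 1) := by positivity
    simp only [hρdef]; linarith
  have hρanti : Antitone ρ := fun M N h => by
    simp only [hρdef]; gcongr
  have hρlim : Tendsto ρ atTop (𝓝 1) := by
    simpa [hρdef] using tendsto_one_div_add_atTop_nhds_zero_nat.const_add (1 : ℝ)
  have hlim := tendsto_setIntegral_of_antitone (μ := volume) (f := F)
    (s := fun N => (g '' {z | ρ N < ‖z‖})ᶜ)
    (fun N => (hg.measurableSet_image (hρ N).le).compl)
    (fun M N h => compl_subset_compl.2 (image_mono fun z hz => (hρanti h).trans_lt hz))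
    (by
      obtain ⟨R, hR⟩ := hg.exists_compl_image_subset (hρ 0).le
      exact ⟨0, (hFc.continuousOn.integrableOn_compact (isCompact_closedBall 0 R)).mono_set hR⟩)
  have hinter : ⋂ N, (g '' {z | ρ N < ‖z‖})ᶜ = (g '' {z | 1 < ‖z‖})ᶜ := by
    rw [← compl_iUnion, ← image_iUnion]
    congr 2
    ext z
    simp only [mem_iUnion, mem_ofPred_eq]
    exact ⟨fun ⟨N, h⟩ => (hρ N).trans h, fun h => (hρlim.eventually (gt_mem_nhds h)).exists⟩
  rw [hinter] at hlim
  have hsum : ∀ N, ∫ w in (g '' {z | ρ N < ‖z‖})ᶜ, F w =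
      π * ((if j = k then (j * (ρ N : ℂ) ^ (2 * j) : ℂ) else 0) -
        ∑' n : ℕ, ((n + 1 : ℕ) : ℂ) * faberCoeff r c j n * conj (faberCoeff r c k n) *
          (((ρ N)⁻¹ ^ (2 * (n + 1)) : ℝ) : ℂ)) := by
    intro N
    have hpi : (π : ℂ) ≠ 0 := by exact_mod_cast Real.pi_ne_zero
    rw [(hg.hasSum_gram_radius j k (hρ N)).tsum_eq, sub_sub_cancel, ← mul_assoc,
      mul_inv_cancel₀ hpi, one_mul]
  simp_rw [hsum] at hlim
  refine tendsto_nhds_unique hlim (Tendsto.const_mul _ (Tendsto.sub ?_ ?_))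
  · split_ifs
    · have : Tendsto (fun N => (j : ℂ) * (ρ N : ℂ) ^ (2 * j)) atTop
          (𝓝 ((j : ℂ) * ((1 : ℝ) : ℂ) ^ (2 * j))) :=
        (((continuous_ofReal.tendsto 1).comp hρlim).pow _).const_mul _
      simpa using this
    · exact tendsto_const_nhds
  -- The dominating series comes from `|ab| ≤ |a|² + |b|²` and the area inequality, since `ρ⁻¹ ≤ 1`.
  · refine tendsto_tsum_of_dominated_convergence
      (bound := fun n => ((n + 1 : ℕ) : ℝ) * ‖faberCoeff r c j n‖ ^ 2 +
        ((n + 1 : ℕ) : ℝ) * ‖faberCoeff r c k n‖ ^ 2)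
      ((hg.summable_faberCoeff_sq j).add (hg.summable_faberCoeff_sq k)) (fun n => ?_)
      (Eventually.of_forall fun N n => ?_)
    · have : Tendsto (fun N => (((ρ N)⁻¹ ^ (2 * (n + 1)) : ℝ) : ℂ)) atTop
          (𝓝 (((1 : ℝ)⁻¹ ^ (2 * (n + 1)) : ℝ) : ℂ)) :=
        (continuous_ofReal.tendsto _).comp ((hρlim.inv₀ one_ne_zero).pow _)
      simpa using this.const_mul (((n + 1 : ℕ) : ℂ) * faberCoeff r c j n * conj (faberCoeff r c k n))
    · have h1 : (ρ N)⁻¹ ^ (2 * (n + 1)) ≤ 1 :=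
        pow_le_one₀ (inv_nonneg.2 (by linarith [hρ N])) (inv_le_one_of_one_le₀ (hρ N).le)
      have h0 : 0 ≤ (ρ N)⁻¹ ^ (2 * (n + 1)) := pow_nonneg (inv_nonneg.2 (by linarith [hρ N])) _
      rw [norm_mul, norm_mul, norm_mul, RCLike.norm_conj, Complex.norm_natCast, norm_real,
        Real.norm_of_nonneg h0, ← mul_add]
      refine (mul_le_of_le_one_right (by positivity) h1).trans ?_
      rw [mul_assoc]
      gcongr
      nlinarith [sq_nonneg (‖faberCoeff r c j n‖ - ‖faberCoeff r c k n‖),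
        sq_nonneg (‖faberCoeff r c j n‖), sq_nonneg (‖faberCoeff r c k n‖)]

end IsUnivalentAtInfinity

end GramLimit

/-! ### The Grunsky expansion from the Faber tails. -/

section Expansion

open Complex Set Metric Filter
open scoped Real Topology ComplexConjugate

/-- The Grunsky coefficients of `g z = r z + c₀ + c₁ / z + ⋯`. -/
noncomputable def grunskyCoeff (r : ℝ) (c : ℕ → ℂ) (k l : ℕ+) : ℂ :=
  faberCoeff r c k l.natPred / k

namespace IsUnivalentAtInfinity

variable {g : ℂ → ℂ} {r : ℝ} {c : ℕ → ℂ}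

/-- A single term of the area inequality, with `m ≤ m²`. Linear growth in `m`, uniform in `n`,
suffices for the double Grunsky series to converge absolutely on the full bidisc. -/
theorem norm_faberCoeff_le (hg : IsUnivalentAtInfinity g r c) (m n : ℕ) :
    ‖faberCoeff r c m n‖ ≤ m := by
  have h1 := hg.sum_faberCoeff_le m (n + 1)
  have h2 : ((n + 1 : ℕ) : ℝ) * ‖faberCoeff r c m n‖ ^ 2 ≤ m :=
    (Finset.single_le_sum (f := fun n : ℕ => ((n + 1 : ℕ) : ℝ) * ‖faberCoeff r c m n‖ ^ 2)
      (fun i _ => by positivity) (Finset.self_mem_range_succ n)).trans h1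
  have h3 : ‖faberCoeff r c m n‖ ^ 2 ≤ m :=
    (le_mul_of_one_le_left (by positivity) (by simp)).trans h2
  have h4 : (m : ℝ) ≤ (m : ℝ) ^ 2 := by exact_mod_cast Nat.le_self_pow two_ne_zero m
  exact abs_le_of_sq_le_sq' (h3.trans h4) (by positivity) |>.2

theorem norm_grunskyCoeff_le (hg : IsUnivalentAtInfinity g r c) (k l : ℕ+) :
    ‖grunskyCoeff r c k l‖ ≤ 1 := by
  rw [grunskyCoeff, norm_div, Complex.norm_natCast]
  exact div_le_one_of_le₀ (hg.norm_faberCoeff_le _ _) (by positivity)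

theorem norm_faberTail_le (hg : IsUnivalentAtInfinity g r c) (m : ℕ) {v : ℂ} (hv : ‖v‖ < 1) :
    ‖faberTail r c m v‖ ≤ m * (1 - ‖v‖)⁻¹ := by
  rw [← (hg.hasSum_faberTail m hv).tsum_eq]
  refine tsum_of_norm_bounded ((hasSum_geometric_of_lt_one (norm_nonneg v) hv).mul_left (m : ℝ))
    fun n => ?_
  rw [norm_mul, norm_pow]
  have h1 : ‖v‖ ^ (n + 1) ≤ ‖v‖ ^ n := pow_le_pow_of_le_one (norm_nonneg v) hv.le (by omega)
  exact mul_le_mul (hg.norm_faberCoeff_le m n) h1 (by positivity) (by positivity)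

/-- For `s` between `max |u| |v|` and `1`, boundedness of `c_k s^k` gives `|kernelCoeff i v| ≤ K
s^{-i}`, and `|u| < s`. -/
theorem summable_kernelSeries (hg : IsUnivalentAtInfinity g r c) {u v : ℂ} (hu : ‖u‖ < 1)
    (hv : ‖v‖ < 1) : Summable fun i => ‖kernelSeries r c v i * u ^ i‖ := by
  obtain ⟨s, h1, h2⟩ := exists_between (max_lt hu hv)
  obtain ⟨hus, hvs⟩ := max_lt_iff.1 h1
  have hs : 0 < s := (norm_nonneg u).trans_lt hus
  obtain ⟨M, hM⟩ := (hg.summable s (by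
    rwa [norm_real, Real.norm_of_nonneg hs.le])).tendsto_atTop_zero.norm.bddAbove_range
  have hM' : ∀ k, ‖c k‖ ≤ M * s⁻¹ ^ k := fun k => by
    have := hM ⟨k, rfl⟩
    simp only [norm_mul, norm_pow, norm_real, Real.norm_of_nonneg hs.le] at this
    rw [inv_pow, ← div_eq_mul_inv]
    exact (le_div_iff₀ (by positivity)).2 this
  set K := ‖v / r‖ * (M * (1 - s⁻¹ * ‖v‖)⁻¹) with hK
  have hb : ∀ i, ‖kernelCoeff r c i v‖ ≤ K * s⁻¹ ^ i := by
    intro i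
    rw [kernelCoeff, norm_mul, hK, mul_assoc]
    gcongr
    have hgeo := (hasSum_geometric_of_lt_one (r := s⁻¹ * ‖v‖) (by positivity)
      ((inv_mul_lt_one₀ hs).2 hvs)).mul_left (M * s⁻¹ ^ i)
    refine (tsum_of_norm_bounded hgeo fun j => ?_).trans (le_of_eq (by ring))
    rw [norm_mul, norm_pow, mul_pow, ← mul_assoc, mul_assoc M, ← pow_add]
    gcongr
    exact hM' _
  have hgeo : Summable fun i : ℕ => max 1 K * (s⁻¹ * ‖u‖) ^ i :=
    (summable_geometric_of_lt_one (by positivity) ((inv_mul_lt_one₀ hs).2 hus)).mul_left _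
  refine Summable.of_nonneg_of_le (fun i => norm_nonneg _) (fun i => ?_) hgeo
  rw [norm_mul, norm_pow, mul_pow, ← mul_assoc]
  gcongr
  rcases i with _ | i
  · simp [kernelSeries]
  · rw [kernelSeries, if_neg (by omega), norm_neg]
    refine (hb _).trans ?_
    gcongr
    exact le_max_right _ _

/-- Multiplying the series by `1 - z/ζ` and applying `kernelSeries_succ` termwise recovers the
expansion of `g ζ`. -/
theorem tsum_kernelSeries (hg : IsUnivalentAtInfinity g r c) {ζ z : ℂ} (hζ : 1 < ‖ζ‖)
    (hz : 1 < ‖z‖) (hne : ζ ≠ z) :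
    ∑' i, kernelSeries r c z⁻¹ i * ζ⁻¹ ^ i = (g ζ - g z) / (r * (ζ - z)) := by
  have hζ0 : ζ ≠ 0 := by rintro rfl; simp at hζ; linarith
  have hr : (r : ℂ) ≠ 0 := by exact_mod_cast hg.pos.ne'
  have hu : ‖ζ⁻¹‖ < 1 := by rw [norm_inv]; exact inv_lt_one_of_one_lt₀ hζ
  have hv : ‖z⁻¹‖ < 1 := by rw [norm_inv]; exact inv_lt_one_of_one_lt₀ hz
  have hs := (hg.summable_kernelSeries hu hv).of_norm.hasSum
  set Ψ := ∑' i, kernelSeries r c z⁻¹ i * ζ⁻¹ ^ i with hΨ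
  have h1 := (hasSum_nat_add_iff' 1).2 hs
  have h2 := h1.sub (hs.mul_left (z * ζ⁻¹))
  simp only [Finset.range_one, Finset.sum_singleton, pow_zero, mul_one] at h2
  have h3 : HasSum (fun k => ζ⁻¹ / r * (c k * ζ⁻¹ ^ k) -
      (if k = 0 then ζ⁻¹ / r * g z else 0)) (ζ⁻¹ / r * (g ζ - r * ζ) - ζ⁻¹ / r * g z) :=
    ((hg.expansion ζ hζ).mul_left _).sub (hasSum_ite_eq 0 _)
  have h4 := h2.unique (h3.congr_fun fun k => by
    have := hg.kernelSeries_succ k hz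
    have h5 : kernelSeries r c z⁻¹ (k + 1) * ζ⁻¹ ^ (k + 1) -
        z * ζ⁻¹ * (kernelSeries r c z⁻¹ k * ζ⁻¹ ^ k) =
        (kernelSeries r c z⁻¹ (k + 1) - z * kernelSeries r c z⁻¹ k) * (ζ⁻¹ * ζ⁻¹ ^ k) := by
      rw [pow_succ]; ring
    rw [h5, this]
    split_ifs with h
    · subst h; simp; ring
    · ring)
  have h6 : kernelSeries r c z⁻¹ 0 = 1 := by simp [kernelSeries]
  rw [h6] at h4
  have hsub : ζ - z ≠ 0 := sub_ne_zero.2 hne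
  rw [eq_div_iff (mul_ne_zero hr hsub)]
  field_simp at h4
  linear_combination h4

/-- The logarithm of the kernel, in terms of the Faber polynomials. -/
theorem exp_tsum_faberTail (hg : IsUnivalentAtInfinity g r c) {u v : ℂ} (hu : ‖u‖ < 1)
    (hv : ‖v‖ < 1) :
    cexp (∑' k : ℕ, -(faberTail r c k v / k) * u ^ k) = ∑' i, kernelSeries r c v i * u ^ i := by
  have hTs : ∀ u : ℂ, ‖u‖ < 1 → Summable fun k : ℕ => ‖faberTail r c k v * u ^ k‖ := by
    intro u hu
    have h1 := summable_pow_mul_geometric_of_norm_lt_one (R := ℝ) 1 (r := ‖u‖) (by simpa using hu)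
    refine Summable.of_nonneg_of_le (fun _ => norm_nonneg _) (fun k => ?_)
      (h1.mul_left ((1 - ‖v‖)⁻¹))
    rw [norm_mul, norm_pow, pow_one, ← mul_assoc, mul_comm (1 - ‖v‖)⁻¹]
    gcongr
    exact hg.norm_faberTail_le k hv
  have hSs : ∀ u : ℂ, ‖u‖ < 1 → Summable fun k : ℕ => -(faberTail r c k v / k) * u ^ k := by
    intro u hu
    refine Summable.of_norm_bounded (hTs u hu) fun k => ?_
    rw [norm_mul, norm_neg, norm_div, norm_mul, Complex.norm_natCast]
    gcongr
    rcases k with _ | k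
    · simp
    · exact div_le_self (norm_nonneg _) (by simp)
  have hPs : ∀ u : ℂ, ‖u‖ < 1 → Summable fun i => kernelSeries r c v i * u ^ i :=
    fun u hu => (hg.summable_kernelSeries hu hv).of_norm
  set S : ℂ → ℂ := fun u => ∑' k : ℕ, -(faberTail r c k v / k) * u ^ k with hS
  set Ψ : ℂ → ℂ := fun u => ∑' i, kernelSeries r c v i * u ^ i with hΨ
  have hSd := fun u hu => hasDerivAt_powerSeries hSs (v := u) hu
  have hΨd := fun u hu => hasDerivAt_powerSeries hPs (v := u) hu
  -- This is `Ψ' = Ψ S'`: the Cauchy product of `Ψ` with the tails is `-u Ψ'`. The factor `u` must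
  -- be cancelled, so `u = 0` is treated separately.
  have hode : ∀ u : ℂ, ‖u‖ < 1 →
      (∑' k : ℕ, k * kernelSeries r c v k * u ^ (k - 1)) =
        Ψ u * ∑' k : ℕ, k * -(faberTail r c k v / k) * u ^ (k - 1) := by
    intro u hu
    by_cases h0 : u = 0
    · subst h0
      have hz : ∀ k : ℕ, k ≠ 1 → ∀ f : ℕ → ℂ, (k : ℂ) * f k * (0 : ℂ) ^ (k - 1) = 0 := by
        intro k hk f
        rcases k with _ | k
        · simp
        · rw [Nat.add_sub_cancel, zero_pow (by omega), mul_zero]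
      rw [tsum_eq_single 1 fun k hk => hz k hk _,
        tsum_eq_single 1 fun k hk => hz k hk fun k => -(faberTail r c k v / k)]
      have hΨ0 : Ψ 0 = 1 := by
        rw [hΨ]
        simp only
        rw [tsum_eq_single 0 fun k hk => by rw [zero_pow hk, mul_zero]]
        simp [kernelSeries]
      rw [hΨ0, faberTail_succ]
      simp [kernelSeries]
    · refine mul_left_cancel₀ h0 ?_
      have hcau := tsum_mul_tsum_eq_tsum_sum_range_of_summable_norm
        (hg.summable_kernelSeries hu hv) (hTs u hu)
      have hterm : ∀ k : ℕ, ∑ i ∈ Finset.range (k + 1), kernelSeries r c v i * u ^ i *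
          (faberTail r c (k - i) v * u ^ (k - i)) = -(u * (k * kernelSeries r c v k * u ^ (k - 1))) := by
        intro k
        have : ∀ i ∈ Finset.range (k + 1), kernelSeries r c v i * u ^ i *
            (faberTail r c (k - i) v * u ^ (k - i)) =
            kernelSeries r c v i * faberTail r c (k - i) v * u ^ k := by
          intro i hi
          have hik : i + (k - i) = k := by have := Finset.mem_range.1 hi; omega
          calc _ = kernelSeries r c v i * faberTail r c (k - i) v * (u ^ i * u ^ (k - i)) := by ring
            _ = _ := by rw [← pow_add, hik]
        rw [Finset.sum_congr rfl this, ← Finset.sum_mul, sum_kernelSeries_mul_faberTail]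
        rcases k with _ | k
        · simp
        · rw [Nat.add_sub_cancel, pow_succ]; ring
      simp_rw [hterm] at hcau
      rw [tsum_neg, tsum_mul_left] at hcau
      have hT : u * ∑' k : ℕ, k * -(faberTail r c k v / k) * u ^ (k - 1) =
          -∑' k, faberTail r c k v * u ^ k := by
        rw [← tsum_mul_left, ← tsum_neg]
        refine tsum_congr fun k => ?_
        rcases k with _ | k
        · simp [faberTail_zero]
        · have : ((k + 1 : ℕ) : ℂ) ≠ 0 := by exact_mod_cast Nat.succ_ne_zero k
          rw [Nat.add_sub_cancel, pow_succ]
          field_simp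
      rw [mul_left_comm, hT]
      linear_combination hcau
  -- By the differential equation `Ψ exp(-S)` is constant, equal to its value `1` at `0`. This also
  -- selects the logarithm vanishing at infinity.
  have hK : ∀ u ∈ ball (0 : ℂ) 1, HasDerivAt (fun u => Ψ u * cexp (-S u)) 0 u := by
    intro u hu
    have hu := mem_ball_zero_iff.1 hu
    have := (hΨd u hu).mul ((hSd u hu).neg.cexp)
    rw [hode u hu] at this
    refine this.congr_deriv ?_
    change Ψ u * _ * cexp (-S u) + Ψ u * (cexp (-S u) * _) = 0
    ring
  have hconst : Ψ u * cexp (-S u) = Ψ 0 * cexp (-S 0) := by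
    refine isOpen_ball.is_const_of_deriv_eq_zero (convex_ball (0 : ℂ) 1).isPreconnected
      (fun u hu => (hK u hu).differentiableAt.differentiableWithinAt)
      (fun u hu => (hK u hu).deriv) (mem_ball_zero_iff.2 hu) (by simp)
  have hΨ0 : Ψ 0 = 1 := by
    simp only [hΨ]
    rw [tsum_eq_single 0 fun k hk => by rw [zero_pow hk, mul_zero]]
    simp [kernelSeries]
  have hS0 : S 0 = 0 := by
    simp only [hS]
    rw [tsum_eq_single 0 fun k hk => by rw [zero_pow hk, mul_zero]]
    simp
  rw [hΨ0, hS0, neg_zero, Complex.exp_zero, mul_one, Complex.exp_neg] at hconst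
  have := Complex.exp_ne_zero (S u)
  field_simp at hconst
  exact hconst.symm

/-- Summing the double series over `l` first gives `-(faberTail k z⁻¹ / k) ζ^{-k}`; the sum over `k`
is then the logarithm found in `exp_tsum_faberTail`. -/
theorem isExteriorGrunskyCoeff (hg : IsUnivalentAtInfinity g r c) :
    IsExteriorGrunskyCoeff g r (grunskyCoeff r c) := by
  intro ζ z hζ hz hne
  have hu : ‖ζ⁻¹‖ < 1 := by rw [norm_inv]; exact inv_lt_one_of_one_lt₀ hζ
  have hv : ‖z⁻¹‖ < 1 := by rw [norm_inv]; exact inv_lt_one_of_one_lt₀ hz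
  have hgeo : ∀ u : ℂ, ‖u‖ < 1 → Summable fun k : ℕ+ => ‖u‖ ^ (k : ℕ) := fun u hu =>
    (summable_geometric_of_lt_one (norm_nonneg u) hu).comp_injective PNat.coe_injective
  have hsum : Summable fun p : ℕ+ × ℕ+ =>
      -(grunskyCoeff r c p.1 p.2 * ζ⁻¹ ^ (p.1 : ℕ) * z⁻¹ ^ (p.2 : ℕ)) := by
    refine Summable.of_norm_bounded ((hgeo _ hu).mul_of_nonneg (hgeo _ hv)
      (fun _ => by positivity) (fun _ => by positivity)) fun p => ?_
    rw [norm_neg, norm_mul, norm_mul, norm_pow, norm_pow]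
    gcongr
    exact mul_le_of_le_one_left (by positivity) (hg.norm_grunskyCoeff_le _ _)
  refine ⟨_, hsum.hasSum, ?_⟩
  have hfib : ∀ k : ℕ+, HasSum (fun l : ℕ+ =>
      -(grunskyCoeff r c k l * ζ⁻¹ ^ (k : ℕ) * z⁻¹ ^ (l : ℕ)))
      (-(faberTail r c k z⁻¹ / k) * ζ⁻¹ ^ (k : ℕ)) := by
    intro k
    have h1 := hg.hasSum_faberTail k hv
    rw [← Equiv.pnatEquivNat.hasSum_iff] at h1
    have h2 := h1.mul_left (-(ζ⁻¹ ^ (k : ℕ) / k))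
    rw [show -(faberTail r c k z⁻¹ / k) * ζ⁻¹ ^ (k : ℕ) =
      -(ζ⁻¹ ^ (k : ℕ) / k) * faberTail r c k z⁻¹ by ring]
    refine h2.congr_fun fun l => ?_
    simp only [Function.comp_apply, Equiv.pnatEquivNat_apply, grunskyCoeff, PNat.natPred_add_one]
    ring
  have h1 := hsum.hasSum.prod_fiberwise hfib
  have h2 : HasSum (fun k : ℕ => -(faberTail r c k z⁻¹ / k) * ζ⁻¹ ^ k)
      (∑' p : ℕ+ × ℕ+, -(grunskyCoeff r c p.1 p.2 * ζ⁻¹ ^ (p.1 : ℕ) * z⁻¹ ^ (p.2 : ℕ))) := by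
    rw [← PNat.coe_injective.hasSum_iff]
    · exact h1
    · intro k hk
      have : k = 0 := by
        by_contra h
        exact hk ⟨⟨k, Nat.pos_of_ne_zero h⟩, rfl⟩
      simp [this]
  rw [← h2.tsum_eq, hg.exp_tsum_faberTail hu hv, hg.tsum_kernelSeries hζ hz hne]

end IsUnivalentAtInfinity

end Expansion

/-! ### Reduction of `detOneSub` to a matrix determinant. -/

section Determinant

/-- `det (I - T)` in terms of a factorization of `T` through a coordinate space. -/
theorem detOneSub_eq_det {E : Type*} [AddCommGroup E] [Module ℂ E] [TopologicalSpace E] {n : ℕ}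
    (T : E →L[ℂ] E) (S : (Fin n → ℂ) →ₗ[ℂ] E) (S' : E →ₗ[ℂ] (Fin n → ℂ))
    (hS : S' ∘ₗ S = LinearMap.id) (M : Matrix (Fin n) (Fin n) ℂ)
    (hT : (T : E →ₗ[ℂ] E) = S ∘ₗ Matrix.toLin' M ∘ₗ S') :
    detOneSub T = (1 - M).det := by
  set R := LinearMap.range (T : E →ₗ[ℂ] E) with hR
  have hfin : FiniteDimensional ℂ R := by
    refine Submodule.finiteDimensional_of_le (S₂ := LinearMap.range S) ?_
    rw [hR, hT]
    exact LinearMap.range_comp_le_range _ _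
  let X : R →ₗ[ℂ] (Fin n → ℂ) := S' ∘ₗ R.subtype
  have hSS : ∀ x, S' (S x) = x := fun x => LinearMap.congr_fun hS x
  let Y : (Fin n → ℂ) →ₗ[ℂ] R := (S ∘ₗ Matrix.toLin' M).codRestrict R fun x => by
    refine ⟨S x, ?_⟩
    rw [hT]
    simp [hSS]
  have hYX : (T : E →ₗ[ℂ] E).restrict (p := R) (q := R)
      (fun x _ => LinearMap.mem_range_self (T : E →ₗ[ℂ] E) x) = Y ∘ₗ X := by
    exact LinearMap.ext fun x => Subtype.ext (LinearMap.congr_fun hT (x : E))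
  have hXY : X ∘ₗ Y = Matrix.toLin' M := by
    exact LinearMap.ext fun x => hSS _
  unfold detOneSub
  rw [hYX]
  let b := Module.finBasis ℂ R
  let e := Pi.basisFun ℂ (Fin n)
  -- Sylvester's identity `det(1 - YX) = det(1 - XY)` moves the determinant from the range of `T`,
  -- whose dimension may be less than `n`, to the coordinate space.
  rw [← LinearMap.det_toMatrix b, map_sub, LinearMap.toMatrix_id, LinearMap.toMatrix_comp b e b,
    Matrix.det_one_sub_mul_comm, ← LinearMap.toMatrix_comp e b e, hXY]
  congr 2
  exact LinearMap.toMatrix'_toLin' M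

end Determinant

/-! ### Operators on `ℓ²(ℤ₊)` given by contractive families, and their truncations. -/

section Operator

open scoped ComplexConjugate

theorem inner_ellBasis (k : ℕ+) (x : EllTwo) : inner ℂ (ellBasis k) x = x k := by
  rw [ellBasis, lp.inner_single_left]; simp

theorem orthonormal_ellBasis : Orthonormal ℂ ellBasis := by
  rw [orthonormal_iff_ite]
  intro i j
  rw [inner_ellBasis, ellBasis, lp.single_apply]
  by_cases h : i = j
  · subst h; simp
  · simp [h]

theorem summable_norm_sq (x : EllTwo) : Summable fun k => ‖x k‖ ^ 2 := by
  have := (lp.memℓp x).summable (by norm_num)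
  simpa using this

theorem sum_norm_sq_le (x : EllTwo) (s : Finset ℕ+) : ∑ k ∈ s, ‖x k‖ ^ 2 ≤ ‖x‖ ^ 2 := by
  have := lp.sum_rpow_le_norm_rpow (p := 2) (by norm_num) x s
  simpa using this

theorem ellBasis_apply_self (k : ℕ+) : (ellBasis k : EllTwo) k = 1 := by
  simp [ellBasis]

theorem ellBasis_apply_of_ne {k l : ℕ+} (h : l ≠ k) : (ellBasis k : EllTwo) l = 0 := by
  simp [ellBasis, lp.single_apply, h]

/-- A family of vectors with `‖∑ x k • c k‖² ≤ ∑ |x k|²` is the image of the standard basis under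
a bounded operator. -/
theorem exists_clm_of_contractive (c : ℕ+ → EllTwo)
    (h : ∀ (s : Finset ℕ+) (x : ℕ+ → ℂ), ‖∑ k ∈ s, x k • c k‖ ^ 2 ≤ ∑ k ∈ s, ‖x k‖ ^ 2) :
    ∃ C : EllTwo →L[ℂ] EllTwo, ∀ k, C (ellBasis k) = c k := by
  have hs : ∀ x : EllTwo, Summable fun k => x k • c k := by
    intro x
    rw [summable_iff_vanishing_norm]
    intro ε hε
    -- The Cauchy criterion for `∑ |x k|²` is used with `ε²`, because contractivity compares squared
    -- norms.
    obtain ⟨s, hs⟩ := summable_iff_vanishing_norm.1 (summable_norm_sq x) (ε ^ 2) (by positivity)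
    refine ⟨s, fun t ht => ?_⟩
    have h1 := h t x
    have h2 := (le_abs_self _).trans_lt (hs t ht)
    exact lt_of_pow_lt_pow_left₀ 2 hε.le (h1.trans_lt h2)
  let C : EllTwo →ₗ[ℂ] EllTwo :=
    { toFun := fun x => ∑' k, x k • c k
      map_add' := fun x y => by
        rw [← (hs x).tsum_add (hs y)]
        exact tsum_congr fun k => by rw [lp.coeFn_add, Pi.add_apply, add_smul]
      map_smul' := fun a x => by
        rw [RingHom.id_apply, ← (hs x).tsum_const_smul a]
        exact tsum_congr fun k => by rw [lp.coeFn_smul, Pi.smul_apply, smul_assoc] }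
  refine ⟨C.mkContinuous 1 fun x => ?_, fun k => ?_⟩
  · rw [one_mul]
    refine le_of_tendsto ((hs x).hasSum.norm) (Filter.Eventually.of_forall fun s => ?_)
    exact le_of_sq_le_sq ((h s x).trans (sum_norm_sq_le x s)) (norm_nonneg x)
  · change ∑' l, (ellBasis k : EllTwo) l • c l = c k
    rw [tsum_eq_single k fun l hl => by rw [ellBasis_apply_of_ne hl, zero_smul],
      ellBasis_apply_self, one_smul]

theorem truncProj_apply (n : ℕ) (x : EllTwo) :
    truncProj n x = ∑ i : Fin n, x (i : ℕ).succPNat • ellBasis (i : ℕ).succPNat := by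
  rw [truncProj, sum_apply, Finset.sum_range]
  refine Finset.sum_congr rfl fun i _ => ?_
  rw [InnerProductSpace.rankOne_apply, inner_ellBasis]

/-- With `B = C^*`, the compression of `B B^* = C^* C` to the first `n` coordinates is the Gram
matrix of the vectors `C e_i`. -/
theorem truncDet_adjoint (n : ℕ) (C : EllTwo →L[ℂ] EllTwo) :
    truncDet n (ContinuousLinearMap.adjoint C) =
      (1 - Matrix.of fun i j : Fin n => inner ℂ (C (ellBasis (i : ℕ).succPNat))
        (C (ellBasis (j : ℕ).succPNat))).det := by
  let S : (Fin n → ℂ) →ₗ[ℂ] EllTwo :=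
    Fintype.linearCombination ℂ fun i : Fin n => ellBasis (i : ℕ).succPNat
  let S' : EllTwo →ₗ[ℂ] (Fin n → ℂ) := LinearMap.pi fun i : Fin n =>
    (innerSL ℂ (ellBasis (i : ℕ).succPNat) : EllTwo →ₗ[ℂ] ℂ)
  have hSa : ∀ x, S x = ∑ i : Fin n, x i • ellBasis (i : ℕ).succPNat := fun x => rfl
  have hS'a : ∀ (x : EllTwo) i, S' x i = inner ℂ (ellBasis (i : ℕ).succPNat) x := fun x i => rfl
  have hinj : Function.Injective fun i : Fin n => (i : ℕ).succPNat :=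
    Nat.succPNat_injective.comp Fin.val_injective
  have hP : ∀ x, truncProj n x = S (S' x) := by
    intro x
    rw [truncProj_apply, hSa]
    simp_rw [hS'a, inner_ellBasis]
  unfold truncDet
  refine detOneSub_eq_det _ S S' ?_ _ ?_
  · refine LinearMap.ext fun x => funext fun i => ?_
    rw [LinearMap.comp_apply, hS'a, hSa]
    exact (orthonormal_ellBasis.comp _ hinj).inner_right_fintype x i
  · refine LinearMap.ext fun x => ?_
    simp only [ContinuousLinearMap.coe_coe, ContinuousLinearMap.comp_apply,
      ContinuousLinearMap.adjoint_adjoint, LinearMap.comp_apply]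
    rw [hP, hP]
    congr 1
    funext i
    rw [hS'a, ContinuousLinearMap.adjoint_inner_right, hSa (S' x), Matrix.toLin'_apply,
      Matrix.mulVec, dotProduct, map_sum, inner_sum]
    refine Finset.sum_congr rfl fun j _ => ?_
    rw [map_smul, inner_smul_right, Matrix.of_apply, mul_comm]

end Operator

/-! ### The Grunsky operator and its truncated determinants. -/

section GrunskyOperator

open Complex Set Metric Filter
open scoped Real Topology ComplexConjugate

namespace IsUnivalentAtInfinity

variable {g : ℂ → ℂ} {r : ℝ} {c : ℕ → ℂ}

/-- The entries of the Gram matrix of the derivatives of the Faber polynomials. -/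
noncomputable def faberGram (g : ℂ → ℂ) (r : ℝ) (c : ℕ → ℂ) (j k : ℕ) : ℂ :=
  ∫ w in (g '' {z | 1 < ‖z‖})ᶜ,
    (faber r c j).derivative.eval w * conj ((faber r c k).derivative.eval w)

theorem norm_sq_grunsky_entry (r : ℝ) (c : ℕ → ℂ) (k l : ℕ+) :
    ‖(Real.sqrt ((k : ℝ) * (l : ℝ)) : ℂ) * grunskyCoeff r c k l‖ ^ 2 =
      (k : ℝ)⁻¹ * (((l.natPred + 1 : ℕ) : ℝ) * ‖faberCoeff r c k l.natPred‖ ^ 2) := by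
  have hk : (0 : ℝ) < (k : ℕ) := by exact_mod_cast k.pos
  rw [PNat.natPred_add_one, grunskyCoeff, norm_mul, norm_div, Complex.norm_natCast, norm_real,
    Real.norm_of_nonneg (Real.sqrt_nonneg _), mul_pow, Real.sq_sqrt (by positivity), div_pow]
  field_simp

theorem memℓp_grunskyRow (hg : IsUnivalentAtInfinity g r c) (k : ℕ+) :
    Memℓp (fun l : ℕ+ => conj ((Real.sqrt ((k : ℝ) * (l : ℝ)) : ℂ) * grunskyCoeff r c k l)) 2 := by
  refine memℓp_gen ?_
  have h := (Equiv.pnatEquivNat.summable_iff.2 (hg.summable_faberCoeff_sq k)).mul_left (k : ℝ)⁻¹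
  refine h.congr fun l => ?_
  have h2 := norm_sq_grunsky_entry r c k l
  rw [← RCLike.norm_conj] at h2
  rw [ENNReal.toReal_ofNat, Real.rpow_ofNat]
  exact h2.symm

/-- The complex conjugate of a row of the Grunsky matrix. -/
noncomputable def grunskyRow (hg : IsUnivalentAtInfinity g r c) (k : ℕ+) : EllTwo :=
  ⟨fun l : ℕ+ => conj ((Real.sqrt ((k : ℝ) * (l : ℝ)) : ℂ) * grunskyCoeff r c k l),
    hg.memℓp_grunskyRow k⟩

theorem grunskyRow_apply (hg : IsUnivalentAtInfinity g r c) (k l : ℕ+) :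
    hg.grunskyRow k l = conj ((Real.sqrt ((k : ℝ) * (l : ℝ)) : ℂ) * grunskyCoeff r c k l) := rfl

/-- Rows are conjugated because the inner product is antilinear in its first slot, so this is the
`(j, k)` entry of `B B^*`. The series is the one in `gram_faber_compl` divided by `√(jk)`. -/
theorem inner_grunskyRow (hg : IsUnivalentAtInfinity g r c) (j k : ℕ+) :
    inner ℂ (hg.grunskyRow j) (hg.grunskyRow k) =
      (if j = k then 1 else 0) - (π : ℂ)⁻¹ *
        (faberGram g r c j k / ((Real.sqrt (j : ℕ) : ℂ) * (Real.sqrt (k : ℕ) : ℂ))) := by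
  have hpi : (π : ℂ) ≠ 0 := by exact_mod_cast Real.pi_ne_zero
  have hsq : ∀ m : ℕ+, (Real.sqrt (m : ℕ) : ℂ) * (Real.sqrt (m : ℕ) : ℂ) = (m : ℕ) := fun m => by
    rw [← ofReal_mul, Real.mul_self_sqrt (by positivity), ofReal_natCast]
  have hne : ∀ m : ℕ+, (Real.sqrt (m : ℕ) : ℂ) ≠ 0 := fun m => by
    have : (0 : ℝ) < (m : ℕ) := by exact_mod_cast m.pos
    exact_mod_cast (Real.sqrt_pos.2 this).ne'
  have hterm : ∀ l : ℕ+, inner ℂ (hg.grunskyRow j l) (hg.grunskyRow k l) =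
      ((Real.sqrt (j : ℕ) : ℂ) * (Real.sqrt (k : ℕ) : ℂ))⁻¹ *
        (((l.natPred + 1 : ℕ) : ℂ) * faberCoeff r c j l.natPred *
          conj (faberCoeff r c k l.natPred)) := by
    intro l
    rw [grunskyRow_apply, grunskyRow_apply, RCLike.inner_apply, RingHomCompTriple.comp_apply,
      RingHom.id_apply, PNat.natPred_add_one, grunskyCoeff, grunskyCoeff,
      Real.sqrt_mul (by positivity), Real.sqrt_mul (by positivity), ← hsq l, ← hsq j, ← hsq k]
    simp only [map_mul, map_div₀, conj_ofReal, ofReal_mul]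
    have h1 := hne j
    have h2 := hne k
    field_simp
  have h1 := lp.hasSum_inner (𝕜 := ℂ) (hg.grunskyRow j) (hg.grunskyRow k)
  simp_rw [hterm] at h1
  have h2 : (∑' n : ℕ, ((n + 1 : ℕ) : ℂ) * faberCoeff r c j n * conj (faberCoeff r c k n)) =
      ∑' l : ℕ+, ((l.natPred + 1 : ℕ) : ℂ) * faberCoeff r c j l.natPred *
          conj (faberCoeff r c k l.natPred) := by
    rw [← Equiv.pnatEquivNat.tsum_eq]; rfl
  rw [← h1.tsum_eq, tsum_mul_left, ← h2, faberGram, hg.gram_faber_compl j k]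
  have h3 := hne j
  have h4 := hne k
  by_cases h : j = k
  · subst h
    rw [if_pos rfl, if_pos rfl, ← hsq j]
    field_simp
    ring
  · rw [if_neg h, if_neg (fun h' => h (PNat.coe_injective h'))]
    field_simp
    ring

theorem integrableOn_faber_mul (hg : IsUnivalentAtInfinity g r c) (j k : ℕ) :
    IntegrableOn (fun w => (faber r c j).derivative.eval w *
      conj ((faber r c k).derivative.eval w)) (g '' {z | 1 < ‖z‖})ᶜ := by
  obtain ⟨R, hR⟩ := hg.exists_compl_image_subset le_rfl
  have hc : Continuous fun w => (faber r c j).derivative.eval w *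
      conj ((faber r c k).derivative.eval w) :=
    (Polynomial.continuous _).mul (continuous_conj.comp (Polynomial.continuous _))
  exact (hc.continuousOn.integrableOn_compact (isCompact_closedBall 0 R)).mono_set hR

/-- The difference of the two sides is `π⁻¹ ∫ |∑ y_j F_j'|²`, which is nonnegative; here `y_j =
conj(x_j) / √j`. -/
theorem norm_sum_grunskyRow_le (hg : IsUnivalentAtInfinity g r c) (s : Finset ℕ+) (x : ℕ+ → ℂ) :
    ‖∑ k ∈ s, x k • hg.grunskyRow k‖ ^ 2 ≤ ∑ k ∈ s, ‖x k‖ ^ 2 := by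
  set y : ℕ+ → ℂ := fun j => conj (x j) / (Real.sqrt (j : ℕ) : ℂ) with hy
  have hint : ∑ j ∈ s, ∑ k ∈ s, y j * conj (y k) * faberGram g r c j k =
      ((∫ w in (g '' {z | 1 < ‖z‖})ᶜ, ‖∑ j ∈ s, y j * (faber r c j).derivative.eval w‖ ^ 2 : ℝ) : ℂ) := by
    rw [← integral_complex_ofReal]
    have : ∀ w, ((‖∑ j ∈ s, y j * (faber r c j).derivative.eval w‖ ^ 2 : ℝ) : ℂ) =
        ∑ j ∈ s, ∑ k ∈ s, y j * conj (y k) * ((faber r c j).derivative.eval w *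
          conj ((faber r c k).derivative.eval w)) := by
      intro w
      rw [← normSq_eq_norm_sq, ← mul_conj, map_sum, Finset.sum_mul_sum]
      refine Finset.sum_congr rfl fun j _ => Finset.sum_congr rfl fun k _ => ?_
      rw [map_mul]; ring
    simp_rw [this]
    rw [integral_finsetSum _ fun (j : ℕ+) _ => integrable_finsetSum _ fun (k : ℕ+) _ =>
      (hg.integrableOn_faber_mul j k).const_mul _]
    refine Finset.sum_congr rfl fun j _ => ?_
    rw [integral_finsetSum _ fun (k : ℕ+) _ => (hg.integrableOn_faber_mul j k).const_mul _]
    refine Finset.sum_congr rfl fun k _ => ?_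
    rw [integral_const_mul, faberGram]
  have hnorm : ((‖∑ k ∈ s, x k • hg.grunskyRow k‖ ^ 2 : ℝ) : ℂ) =
      ((∑ k ∈ s, ‖x k‖ ^ 2 : ℝ) : ℂ) - (π : ℂ)⁻¹ *
        ∑ j ∈ s, ∑ k ∈ s, y j * conj (y k) * faberGram g r c j k := by
    have h1 := inner_self_eq_norm_sq_to_K (𝕜 := ℂ) (∑ k ∈ s, x k • hg.grunskyRow k)
    rw [ofReal_pow]
    refine h1.symm.trans ?_
    rw [sum_inner, Finset.mul_sum, ofReal_sum, ← Finset.sum_sub_distrib]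
    refine Finset.sum_congr rfl fun j hj => ?_
    rw [inner_sum, Finset.mul_sum]
    have h2 : ((‖x j‖ ^ 2 : ℝ) : ℂ) = ∑ k ∈ s, if j = k then conj (x j) * x k else 0 := by
      rw [Finset.sum_ite_eq, if_pos hj, mul_comm, mul_conj, normSq_eq_norm_sq]
    rw [h2, ← Finset.sum_sub_distrib]
    refine Finset.sum_congr rfl fun k _ => ?_
    rw [inner_smul_left, inner_smul_right, hg.inner_grunskyRow, hy]
    simp only [map_div₀, conj_ofReal, Complex.conj_conj]
    split_ifs <;> ring
  rw [hint, ← ofReal_inv, ← ofReal_mul, ← ofReal_sub] at hnorm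
  have h3 := ofReal_injective hnorm
  rw [h3]
  have h0 : 0 ≤ ∫ w in (g '' {z | 1 < ‖z‖})ᶜ,
      ‖∑ j ∈ s, y j * (faber r c j).derivative.eval w‖ ^ 2 :=
    integral_nonneg fun w => by positivity
  have := mul_nonneg (inv_nonneg.2 Real.pi_pos.le) h0
  linarith

/-- The Grunsky operator, and the determinants of its truncations. -/
theorem exists_grunskyOperator (hg : IsUnivalentAtInfinity g r c) :
    ∃ B : EllTwo →L[ℂ] EllTwo, IsGrunskyOperator (grunskyCoeff r c) B ∧ ∀ n : ℕ,
      truncDet n B * ((π : ℂ) ^ n * n.factorial) =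
        (Matrix.of fun i j : Fin n => faberGram g r c (i + 1) (j + 1)).det := by
  obtain ⟨C, hC⟩ := exists_clm_of_contractive hg.grunskyRow hg.norm_sum_grunskyRow_le
  refine ⟨ContinuousLinearMap.adjoint C, fun k l => ?_, fun n => ?_⟩
  · rw [← inner_ellBasis, ContinuousLinearMap.adjoint_inner_right, hC, ellBasis,
      lp.inner_single_right, grunskyRow_apply]
    simp
  · have hpi : (π : ℂ) ≠ 0 := by exact_mod_cast Real.pi_ne_zero
    set d : Fin n → ℂ := fun i => (Real.sqrt ((i : ℕ) + 1 : ℕ) : ℂ) with hd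
    have hdne : ∀ i, d i ≠ 0 := fun i => by
      have : (0 : ℝ) < ((i : ℕ) + 1 : ℕ) := by positivity
      exact ofReal_ne_zero.2 (Real.sqrt_pos.2 this).ne'
    -- The weights `√(i + 1)` undo the normalization of the Grunsky matrix; their total contribution
    -- to the determinant is `n!`, and the scalar `π` gives `π^n`.
    have hM : (Matrix.of fun i j : Fin n => faberGram g r c (i + 1) (j + 1)) =
        (π : ℂ) • (Matrix.diagonal d * (1 - Matrix.of fun i j : Fin n =>
          inner ℂ (C (ellBasis (i : ℕ).succPNat)) (C (ellBasis (j : ℕ).succPNat))) *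
          Matrix.diagonal d) := by
      ext i j
      rw [Matrix.smul_apply, Matrix.mul_diagonal, Matrix.diagonal_mul, Matrix.sub_apply,
        Matrix.of_apply, Matrix.of_apply, hC, hC, hg.inner_grunskyRow, Matrix.one_apply]
      have h1 : ((i : ℕ).succPNat = (j : ℕ).succPNat) = (i = j) := by
        rw [Nat.succPNat_inj, Fin.val_inj]
      simp only [h1, Nat.succPNat_coe, Nat.succ_eq_add_one, sub_sub_cancel, smul_eq_mul]
      have hi := hdne i
      have hj := hdne j
      simp only [hd] at hi hj ⊢
      field_simp
    rw [hM, Matrix.det_smul, Matrix.det_mul, Matrix.det_mul, Matrix.det_diagonal, truncDet_adjoint,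
      Fintype.card_fin]
    have hprod : (∏ i, d i) * ∏ i, d i = (n.factorial : ℂ) := by
      rw [← Finset.prod_mul_distrib, ← Finset.prod_range_add_one_eq_factorial, Finset.prod_range,
        Nat.cast_prod]
      refine Finset.prod_congr rfl fun i _ => ?_
      rw [hd, ← ofReal_mul, Real.mul_self_sqrt (by positivity), ofReal_natCast]
    rw [← hprod]
    ring

end IsUnivalentAtInfinity

end GrunskyOperator

/-! ### Partition functions as moment determinants, and the passage to the Faber basis. -/

section CoulombGas

open Complex Set Metric Filter
open scoped Real Topology ComplexConjugate Matrix

/-- Andréief's identity. -/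
theorem integral_norm_det_sq {n : ℕ} (μ : Measure ℂ) [SigmaFinite μ] (φ : Fin n → ℂ → ℂ)
    (h : ∀ i j, Integrable (fun z => φ i z * conj (φ j z)) μ) :
    Integrable (fun z : Fin n → ℂ => ((‖(Matrix.of fun j k => φ j (z k)).det‖ ^ 2 : ℝ) : ℂ))
      (Measure.pi fun _ => μ) ∧
    ∫ z : Fin n → ℂ, ((‖(Matrix.of fun j k => φ j (z k)).det‖ ^ 2 : ℝ) : ℂ)
      ∂(Measure.pi fun _ => μ) =
      n.factorial * (Matrix.of fun i j => ∫ z, φ i z * conj (φ j z) ∂μ).det := by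
  set H : Matrix (Fin n) (Fin n) ℂ := Matrix.of fun i j => ∫ z, φ i z * conj (φ j z) ∂μ with hH
  have hexp : ∀ z : Fin n → ℂ, ((‖(Matrix.of fun j k => φ j (z k)).det‖ ^ 2 : ℝ) : ℂ) =
      ∑ σ : Equiv.Perm (Fin n), ∑ τ : Equiv.Perm (Fin n),
        ((Equiv.Perm.sign σ : ℤ) : ℂ) * ((Equiv.Perm.sign τ : ℤ) : ℂ) *
          ∏ k, (φ (σ k) (z k) * conj (φ (τ k) (z k))) := by
    intro z
    rw [← normSq_eq_norm_sq, ← mul_conj, Matrix.det_apply', map_sum, Finset.sum_mul_sum]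
    refine Finset.sum_congr rfl fun σ _ => Finset.sum_congr rfl fun τ _ => ?_
    simp only [Matrix.of_apply, map_mul, map_prod, map_intCast, Finset.prod_mul_distrib]
    ring
  have hprod : ∀ σ τ : Equiv.Perm (Fin n), Integrable (fun z : Fin n → ℂ =>
      ((Equiv.Perm.sign σ : ℤ) : ℂ) * ((Equiv.Perm.sign τ : ℤ) : ℂ) *
          ∏ k, (φ (σ k) (z k) * conj (φ (τ k) (z k)))) (Measure.pi fun _ => μ) := fun σ τ =>
    (Integrable.fintype_prod (f := fun k z => φ (σ k) z * conj (φ (τ k) z))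
      fun k => h (σ k) (τ k)).const_mul _
  simp_rw [hexp]
  refine ⟨integrable_finsetSum _ fun σ _ => integrable_finsetSum _ fun τ _ => hprod σ τ, ?_⟩
  rw [integral_finsetSum _ fun σ _ => integrable_finsetSum _ fun τ _ => hprod σ τ]
  have hσ : ∀ σ : Equiv.Perm (Fin n), ∫ z : Fin n → ℂ, ∑ τ : Equiv.Perm (Fin n),
        ((Equiv.Perm.sign σ : ℤ) : ℂ) * ((Equiv.Perm.sign τ : ℤ) : ℂ) *
          ∏ k, (φ (σ k) (z k) * conj (φ (τ k) (z k))) ∂(Measure.pi fun _ => μ) = H.det := by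
    intro σ
    rw [integral_finsetSum _ fun τ _ => hprod σ τ]
    -- For fixed `σ` the sum over `τ` is a determinant with rows permuted by `σ`, and the sign
    -- undoes the permutation. Each of the `n!` choices of `σ` therefore contributes `H.det`.
    have h1 : ((Equiv.Perm.sign σ : ℤ) : ℂ) * (H.submatrix σ id)ᵀ.det = H.det := by
      rw [Matrix.det_transpose, Matrix.det_permute, ← mul_assoc, ← Int.cast_mul,
        ← Units.val_mul, Int.units_mul_self]
      simp
    rw [← h1, Matrix.det_apply', Finset.mul_sum]
    refine Finset.sum_congr rfl fun τ _ => ?_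
    rw [integral_const_mul, integral_fintype_prod_eq_prod
      (f := fun k z => φ (σ k) z * conj (φ (τ k) z)), mul_assoc]
    rfl
  rw [Finset.sum_congr rfl fun σ _ => hσ σ, Finset.sum_const, Finset.card_univ, Fintype.card_perm,
    Fintype.card_fin, nsmul_eq_mul]

theorem restrict_configSpace (n : ℕ) (Ω : Set ℂ) :
    (volume : Measure (Fin n → ℂ)).restrict (configSpace n Ω) =
      Measure.pi fun _ => (volume : Measure ℂ).restrict Ω := by
  have : configSpace n Ω = Set.univ.pi fun _ => Ω := by
    ext z; simp [configSpace]
  rw [this, volume_pi, Measure.restrict_pi_pi]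

theorem coulombWeight_eq (n : ℕ) (z : Fin n → ℂ) :
    coulombWeight n z = ‖(Matrix.of fun j k : Fin n => z k ^ (j : ℕ)).det‖ ^ 2 := by
  have : (Matrix.of fun j k : Fin n => z k ^ (j : ℕ)) = (Matrix.vandermonde z)ᵀ := by
    ext i j; rfl
  rw [this, Matrix.det_transpose, Matrix.det_vandermonde, norm_prod, ← Finset.prod_pow]
  refine Finset.prod_congr rfl fun k _ => ?_
  rw [norm_prod, ← Finset.prod_pow]
  refine Finset.prod_congr rfl fun l _ => ?_
  rw [norm_sub_rev]

/-- The matrix of moments of a plane set. -/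
noncomputable def momentMatrix (n : ℕ) (Ω : Set ℂ) : Matrix (Fin n) (Fin n) ℂ :=
  Matrix.of fun i j => ∫ w in Ω, w ^ (i : ℕ) * conj (w ^ (j : ℕ))

theorem integrableOn_moment {Ω : Set ℂ} (hΩ : Bornology.IsBounded Ω) (i j : ℕ) :
    IntegrableOn (fun w : ℂ => w ^ i * conj (w ^ j)) Ω := by
  obtain ⟨R, hR⟩ := hΩ.subset_closedBall 0
  have hc : Continuous fun w : ℂ => w ^ i * conj (w ^ j) := by fun_prop
  exact (hc.continuousOn.integrableOn_compact (isCompact_closedBall 0 R)).mono_set hR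

theorem integrableOn_coulombWeight (n : ℕ) {Ω : Set ℂ} (hΩ : Bornology.IsBounded Ω) :
    IntegrableOn (coulombWeight n) (configSpace n Ω) := by
  have h := (integral_norm_det_sq (volume.restrict Ω) (fun (j : Fin n) z => z ^ (j : ℕ))
    fun i j => integrableOn_moment hΩ i j).1.re
  rw [IntegrableOn, restrict_configSpace]
  refine h.congr (Eventually.of_forall fun z => ?_)
  simp only [coulombWeight_eq]
  exact ofReal_re _

theorem partitionFn_eq_det (n : ℕ) {Ω : Set ℂ} (hΩ : Bornology.IsBounded Ω) :
    (partitionFn n Ω : ℂ) = (momentMatrix n Ω).det := by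
  have h := (integral_norm_det_sq (volume.restrict Ω) (fun (j : Fin n) z => z ^ (j : ℕ))
    fun i j => integrableOn_moment hΩ i j).2
  have hn : (n.factorial : ℂ) ≠ 0 := by exact_mod_cast n.factorial_ne_zero
  rw [partitionFn, ofReal_mul, ← integral_complex_ofReal, restrict_configSpace]
  simp_rw [coulombWeight_eq]
  rw [h]
  push_cast
  rw [← mul_assoc, one_div, inv_mul_cancel₀ hn, one_mul]
  rfl

theorem continuous_coulombWeight (n : ℕ) : Continuous (coulombWeight n) := by
  unfold coulombWeight; fun_prop

/-- The weight is continuous and nonnegative, and it is nonzero at any configuration of distinct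
points; an open nonempty plane set is infinite, so one exists. -/
theorem partitionFn_pos (n : ℕ) {Ω : Set ℂ} (hb : Bornology.IsBounded Ω) (ho : IsOpen Ω)
    (hne : Ω.Nonempty) : 0 < partitionFn n Ω := by
  have hinf : Ω.Infinite := by
    obtain ⟨w, hw⟩ := hne
    exact infinite_of_mem_nhds w (ho.mem_nhds hw)
  have hopen : IsOpen (configSpace n Ω) := by
    have : configSpace n Ω = Set.univ.pi fun _ => Ω := by ext z; simp [configSpace]
    rw [this]
    exact isOpen_set_pi finite_univ fun _ _ => ho
  have hnn : ∀ z, 0 ≤ coulombWeight n z := fun z => by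
    rw [coulombWeight_eq]; positivity
  refine mul_pos (by positivity) ?_
  rw [setIntegral_pos_iff_support_of_nonneg_ae (Eventually.of_forall hnn)
    (integrableOn_coulombWeight n hb)]
  refine IsOpen.measure_pos _ (((continuous_coulombWeight n).isOpen_support).inter hopen) ?_
  let e := hinf.natEmbedding
  refine ⟨fun k : Fin n => (e k : ℂ), ?_, fun k => (e k).2⟩
  rw [Function.mem_support, coulombWeight]
  refine Finset.prod_ne_zero_iff.2 fun k _ => Finset.prod_ne_zero_iff.2 fun l hl => ?_
  refine pow_ne_zero _ (norm_ne_zero_iff.2 (sub_ne_zero.2 fun heq => ?_))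
  have := Fin.val_injective (e.injective (Subtype.ext heq))
  exact (Finset.mem_Ioi.1 hl).ne this

theorem prod_pow_succ_sq (x : ℂ) (n : ℕ) :
    (∏ i ∈ Finset.range n, x ^ (i + 1)) ^ 2 = x ^ (n * (n + 1)) := by
  induction n with
  | zero => simp
  | succ k ih =>
    rw [Finset.prod_range_succ, mul_pow, ih, ← pow_mul, ← pow_add]
    congr 1; ring

namespace IsUnivalentAtInfinity

variable {g : ℂ → ℂ} {r : ℝ} {c : ℕ → ℂ}

/-- The change of basis `L` from monomials to `F_{i+1}'` is triangular with diagonal `(i + 1)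
r^{-(i+1)}`, and it enters once directly and once as its adjoint. -/
theorem det_faberGram (hg : IsUnivalentAtInfinity g r c) (n : ℕ) :
    (Matrix.of fun i j : Fin n => faberGram g r c (i + 1) (j + 1)).det =
      (n.factorial : ℂ) ^ 2 * (r : ℂ)⁻¹ ^ (n * (n + 1)) *
        (momentMatrix n (g '' {z | 1 < ‖z‖})ᶜ).det := by
  obtain ⟨R, hR⟩ := hg.exists_compl_image_subset le_rfl
  have hb : Bornology.IsBounded (g '' {z | 1 < ‖z‖})ᶜ := isBounded_closedBall.subset hR
  set L : Matrix (Fin n) (Fin n) ℂ :=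
    Matrix.of fun i a => (faber r c (i + 1)).derivative.coeff a with hL
  have hev : ∀ (i : Fin n) (w : ℂ), (faber r c (i + 1)).derivative.eval w =
      ∑ a : Fin n, L i a * w ^ (a : ℕ) := by
    intro i w
    rw [Polynomial.eval_eq_sum_range' (n := n), Finset.sum_range]
    · rfl
    · have h1 := Polynomial.natDegree_derivative_le (faber r c (i + 1))
      have h2 := natDegree_faber_le r c (i + 1)
      omega
  have hfac : (Matrix.of fun i j : Fin n => faberGram g r c (i + 1) (j + 1)) =
      L * momentMatrix n (g '' {z | 1 < ‖z‖})ᶜ * L.conjTranspose := by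
    ext i j
    rw [Matrix.of_apply, faberGram]
    simp_rw [hev, map_sum, Finset.sum_mul_sum]
    have hterm : ∀ (a b : Fin n) (w : ℂ), L i a * w ^ (a : ℕ) * conj (L j b * w ^ (b : ℕ)) =
        L i a * conj (L j b) * (w ^ (a : ℕ) * conj (w ^ (b : ℕ))) := fun a b w => by
      rw [map_mul]; ring
    simp_rw [hterm]
    rw [integral_finsetSum _ fun (a : Fin n) _ => integrable_finsetSum _ fun (b : Fin n) _ =>
      (integrableOn_moment hb a b).const_mul _]
    rw [Matrix.mul_apply]
    simp_rw [Matrix.mul_apply, Finset.sum_mul]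
    rw [Finset.sum_comm]
    refine Finset.sum_congr rfl fun a _ => ?_
    rw [integral_finsetSum _ fun (b : Fin n) _ => (integrableOn_moment hb a b).const_mul _]
    refine Finset.sum_congr rfl fun b _ => ?_
    rw [integral_const_mul, Matrix.conjTranspose_apply, momentMatrix, Matrix.of_apply]
    simp only [RCLike.star_def]
    ring
  have hdet : L.det = n.factorial * ∏ i ∈ Finset.range n, (r : ℂ)⁻¹ ^ (i + 1) := by
    rw [Matrix.det_of_isLowerTriangular]
    · rw [← Finset.prod_range_add_one_eq_factorial, Nat.cast_prod, ← Finset.prod_mul_distrib,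
        Finset.prod_range]
      refine Finset.prod_congr rfl fun i _ => ?_
      rw [hL, Matrix.of_apply, Polynomial.coeff_derivative, coeff_faber_self]
      push_cast; ring
    · intro i j hij
      have hij' : i < j := hij
      rw [hL, Matrix.of_apply, Polynomial.coeff_derivative, Polynomial.coeff_eq_zero_of_natDegree_lt,
        zero_mul]
      have h2 := natDegree_faber_le r c (i + 1)
      have h3 : (i : ℕ) < j := hij'
      omega
  rw [hfac, Matrix.det_mul, Matrix.det_mul, Matrix.det_conjTranspose, hdet, ← prod_pow_succ_sq]
  simp only [RCLike.star_def, map_mul, map_prod, map_pow, map_inv₀, conj_ofReal, map_natCast]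
  ring

/-- The common core of both formulas. It asks only that `D` fill the complement of the image up to a
null set, so that it also applies to the punctured domain `1/D^*`. -/
theorem partitionFn_compl (hg : IsUnivalentAtInfinity g r c) {D : Set ℂ} (hDo : IsOpen D)
    (hDn : D.Nonempty) (hdisj : Disjoint D (g '' {z | 1 < ‖z‖}))
    (hnull : volume (D ∪ g '' {z | 1 < ‖z‖})ᶜ = 0) :
    ∃ B : EllTwo →L[ℂ] EllTwo, IsGrunskyOperator (grunskyCoeff r c) B ∧ ∀ n : ℕ,
      IntegrableOn (coulombWeight n) (configSpace n D) ∧ 0 < partitionFn n D ∧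
      truncDet n B = ((n.factorial / π ^ n * r⁻¹ ^ (n * (n + 1)) * partitionFn n D : ℝ) : ℂ) := by
  obtain ⟨B, hB, hdet⟩ := hg.exists_grunskyOperator
  obtain ⟨R, hR⟩ := hg.exists_compl_image_subset le_rfl
  have hsub : D ⊆ (g '' {z | 1 < ‖z‖})ᶜ := disjoint_left.1 hdisj
  have hDb : Bornology.IsBounded D := isBounded_closedBall.subset (hsub.trans hR)
  have hae : ((g '' {z | 1 < ‖z‖})ᶜ : Set ℂ) =ᵐ[volume] D := by
    refine EventuallyLE.antisymm ?_ (LE.le.eventuallyLE hsub)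
    rw [ae_le_set]
    refine measure_mono_null (fun z hz => ?_) hnull
    rw [mem_compl_iff, mem_union, not_or]
    exact ⟨hz.2, hz.1⟩
  refine ⟨B, hB, fun n => ⟨integrableOn_coulombWeight n hDb, partitionFn_pos n hDb hDo hDn, ?_⟩⟩
  have hmom : momentMatrix n (g '' {z | 1 < ‖z‖})ᶜ = momentMatrix n D := by
    ext i j
    exact setIntegral_congr_set hae
  have h := hdet n
  rw [hg.det_faberGram, hmom, ← partitionFn_eq_det n hDb] at h
  have hpi : (π : ℂ) ≠ 0 := by exact_mod_cast Real.pi_ne_zero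
  have hn : (n.factorial : ℂ) ≠ 0 := by exact_mod_cast n.factorial_ne_zero
  have hpin : (π : ℂ) ^ n ≠ 0 := pow_ne_zero _ hpi
  rw [← eq_div_iff (mul_ne_zero hpin hn)] at h
  rw [h]
  push_cast
  field_simp

end IsUnivalentAtInfinity

end CoulombGas

/-! ### The exterior gas as a gas on the inverted domain. -/

section Inversion

open Complex Set Metric Filter
open scoped Real Topology ComplexConjugate Matrix

theorem exteriorCoulombWeight_eq (n : ℕ) (z : Fin n → ℂ) (hz : ∀ k, z k ≠ 0) :
    exteriorCoulombWeight n z =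
      ‖(Matrix.of fun j k : Fin n => (z k)⁻¹ ^ (j : ℕ) * (z k)⁻¹ ^ 2).det‖ ^ 2 := by
  set A : Matrix (Fin n) (Fin n) ℂ := Matrix.of fun j k => (z k)⁻¹ ^ (j : ℕ) * (z k)⁻¹ ^ 2 with hA
  set V : Matrix (Fin n) (Fin n) ℂ := Matrix.of fun j k => z k ^ (j : ℕ) with hV
  -- Reversing the rows turns `z^j` into `z^{n-1-j} = z^{n+1} · z^{-j} z^{-2}`. The factors
  -- `|z|^{2(n+1)}` cancel the exponential weight, and the `z^{-2}` left over provides the Jacobian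
  -- of the inversion.
  have hVA : V.submatrix (Fin.revPerm : Equiv.Perm (Fin n)) id =
      Matrix.of fun j k => z k ^ (n + 1) * A j k := by
    ext j k
    simp only [hV, hA, Matrix.submatrix_apply, Matrix.of_apply, id, Fin.revPerm_apply, Fin.val_rev]
    have hk := hz k
    have hj : n + 1 = (n - (j + 1)) + (j + 2) := by omega
    rw [← pow_add (z k)⁻¹, hj, pow_add (z k), mul_assoc, ← mul_pow, mul_inv_cancel₀ hk, one_pow, mul_one]
  have hdet : ‖V.det‖ = (∏ k, ‖z k‖ ^ (n + 1)) * ‖A.det‖ := by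
    have h1 := congrArg (fun M : Matrix (Fin n) (Fin n) ℂ => ‖M.det‖) hVA
    simp only [Matrix.det_permute, Matrix.det_mul_row] at h1
    rw [norm_mul, norm_mul, norm_prod] at h1
    simp only [norm_pow] at h1
    rw [← h1]
    rcases Int.units_eq_one_or (Equiv.Perm.sign (Fin.revPerm : Equiv.Perm (Fin n))) with h | h <;>
      simp [h]
  have hpos : ∀ k, 0 < ‖z k‖ := fun k => norm_pos_iff.2 (hz k)
  have hexp : Real.exp (-((n : ℝ) + 1) * ∑ k : Fin n, Real.log (‖z k‖ ^ 2)) *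
      (∏ k, ‖z k‖ ^ (n + 1)) ^ 2 = 1 := by
    rw [Finset.mul_sum, Real.exp_sum, ← Finset.prod_pow, ← Finset.prod_mul_distrib]
    refine Finset.prod_eq_one fun k _ => ?_
    have h1 : (‖z k‖ ^ (n + 1)) ^ 2 = Real.exp (((n : ℝ) + 1) * Real.log (‖z k‖ ^ 2)) := by
      rw [← pow_mul, mul_comm (n + 1), pow_mul]
      have h2 : ((n : ℝ) + 1) * Real.log (‖z k‖ ^ 2) = Real.log ((‖z k‖ ^ 2) ^ (n + 1)) := by
        rw [Real.log_pow (x := ‖z k‖ ^ 2) (n + 1)]; push_cast; ring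
      rw [h2, Real.exp_log (pow_pos (pow_pos (hpos k) 2) _)]
    rw [h1, ← Real.exp_add, neg_mul, neg_add_cancel, Real.exp_zero]
  rw [exteriorCoulombWeight, coulombWeight_eq, ← hV, hdet, mul_pow, ← mul_assoc, hexp, one_mul]

theorem hasDerivAt_inv_of_mem {Ω : Set ℂ} (h0 : (0 : ℂ) ∉ Ω) (z : ℂ) (hz : z ∈ Ω) :
    HasDerivAt (fun z : ℂ => z⁻¹) (-(z ^ 2)⁻¹) z :=
  hasDerivAt_inv fun h => h0 (h ▸ hz)

theorem moment_inversion {Ω : Set ℂ} (hΩ : MeasurableSet Ω) (h0 : (0 : ℂ) ∉ Ω)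
    (hb : Bornology.IsBounded ((fun z : ℂ => z⁻¹) '' Ω)) (i j : ℕ) :
    IntegrableOn (fun z : ℂ => z⁻¹ ^ i * z⁻¹ ^ 2 * conj (z⁻¹ ^ j * z⁻¹ ^ 2)) Ω ∧
    ∫ z in Ω, z⁻¹ ^ i * z⁻¹ ^ 2 * conj (z⁻¹ ^ j * z⁻¹ ^ 2) =
      ∫ w in (fun z : ℂ => z⁻¹) '' Ω, w ^ i * conj (w ^ j) := by
  have hd := hasDerivAt_inv_of_mem h0
  have hinj : InjOn (fun z : ℂ => z⁻¹) Ω := inv_injective.injOn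
  have hterm : ∀ z : ℂ, z⁻¹ ^ i * z⁻¹ ^ 2 * conj (z⁻¹ ^ j * z⁻¹ ^ 2) =
      ((‖-(z ^ 2)⁻¹‖ ^ 2 : ℝ) : ℂ) * (z⁻¹ ^ i * conj (z⁻¹ ^ j)) := by
    intro z
    rw [norm_neg, ← inv_pow, ← normSq_eq_norm_sq, ← mul_conj, map_mul]
    ring
  simp_rw [hterm]
  exact ⟨(integrableOn_image_holomorphic hΩ hd hinj (fun w => w ^ i * conj (w ^ j))).1
    (integrableOn_moment hb i j),
    (integral_image_holomorphic hΩ hd hinj (fun w => w ^ i * conj (w ^ j))).symm⟩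

theorem exteriorPartitionFn_eq (n : ℕ) {Ω : Set ℂ} (hΩ : MeasurableSet Ω) (h0 : (0 : ℂ) ∉ Ω)
    (hb : Bornology.IsBounded ((fun z : ℂ => z⁻¹) '' Ω)) :
    IntegrableOn (exteriorCoulombWeight n) (configSpace n Ω) ∧
      exteriorPartitionFn n Ω = partitionFn n ((fun z : ℂ => z⁻¹) '' Ω) := by
  have hA := integral_norm_det_sq (volume.restrict Ω)
    (fun (j : Fin n) z => z⁻¹ ^ (j : ℕ) * z⁻¹ ^ 2) fun i j => (moment_inversion hΩ h0 hb i j).1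
  rw [← restrict_configSpace] at hA
  have hms : MeasurableSet (configSpace n Ω) := by
    have : configSpace n Ω = Set.univ.pi fun _ => Ω := by ext z; simp [configSpace]
    rw [this]
    exact MeasurableSet.univ_pi fun _ => hΩ
  have hw : ∀ z ∈ configSpace n Ω, ((exteriorCoulombWeight n z : ℝ) : ℂ) =
      ((‖(Matrix.of fun j k : Fin n => (z k)⁻¹ ^ (j : ℕ) * (z k)⁻¹ ^ 2).det‖ ^ 2 : ℝ) : ℂ) := by
    intro z hz
    rw [exteriorCoulombWeight_eq n z fun k h => h0 (h ▸ hz k)]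
  refine ⟨?_, ?_⟩
  · have h1 : IntegrableOn (fun z => ((exteriorCoulombWeight n z : ℝ) : ℂ)) (configSpace n Ω) :=
      IntegrableOn.congr_fun hA.1 (fun z hz => (hw z hz).symm) hms
    exact h1.re
  · have hn : (n.factorial : ℂ) ≠ 0 := by exact_mod_cast n.factorial_ne_zero
    apply ofReal_injective
    rw [partitionFn_eq_det n hb, exteriorPartitionFn, ofReal_mul, ← integral_complex_ofReal,
      setIntegral_congr_fun hms hw, hA.2]
    push_cast
    rw [← mul_assoc, one_div, inv_mul_cancel₀ hn, one_mul]
    congr 1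
    ext i j
    exact (moment_inversion hΩ h0 hb i j).2

end Inversion

/-! ### Holomorphic logarithms on the disc. -/

section Interior

open Complex Set Metric Filter
open scoped Real Topology

/-- Take the primitive `Λ` of `q'/q` with value `ℓ` at `0`; then `q exp(-Λ)` has zero derivative. -/
theorem exists_log_on_ball {q : ℂ → ℂ} (hq : DifferentiableOn ℂ q (ball 0 1))
    (hne : ∀ v ∈ ball (0 : ℂ) 1, q v ≠ 0) {ℓ : ℂ} (hℓ : cexp ℓ = q 0) :
    ∃ Λ : ℂ → ℂ, DifferentiableOn ℂ Λ (ball 0 1) ∧ Λ 0 = ℓ ∧ ∀ v ∈ ball (0 : ℂ) 1,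
      cexp (Λ v) = q v := by
  have hd : DifferentiableOn ℂ (fun v => deriv q v / q v) (ball 0 1) :=
    (hq.deriv isOpen_ball).div hq hne
  obtain ⟨Λ, hΛ0, hΛ⟩ := hd.isExactOn_ball.with_val_at 0 ℓ
  have h0 : (0 : ℂ) ∈ ball (0 : ℂ) 1 := by simp
  have hK : ∀ v ∈ ball (0 : ℂ) 1, HasDerivAt (fun v => q v * cexp (-Λ v)) 0 v := by
    intro v hv
    have h1 := (hq.differentiableAt (isOpen_ball.mem_nhds hv)).hasDerivAt
    refine (h1.mul (hΛ v hv).neg.cexp).congr_deriv ?_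
    have := hne v hv
    field_simp
    simp
  refine ⟨Λ, fun v hv => (hΛ v hv).differentiableAt.differentiableWithinAt, hΛ0, fun v hv => ?_⟩
  have hconst : q v * cexp (-Λ v) = q 0 * cexp (-Λ 0) :=
    isOpen_ball.is_const_of_deriv_eq_zero (convex_ball (0 : ℂ) 1).isPreconnected
      (fun u hu => (hK u hu).differentiableAt.differentiableWithinAt)
      (fun u hu => (hK u hu).deriv) hv h0
  rw [hΛ0, ← hℓ, ← Complex.exp_add, add_neg_cancel, Complex.exp_zero, Complex.exp_neg] at hconst
  have := Complex.exp_ne_zero (Λ v)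
  field_simp at hconst
  exact hconst.symm

end Interior

/-! ### The interior map through its inversion, and its Grunsky coefficients. -/

section InteriorMap

open Complex Set Metric Filter
open scoped Real Topology

variable {D : Set ℂ} {f : ℂ → ℂ} {r₀ : ℝ}

theorem interior_map_ne_zero (hf : IsInteriorConformalMap D f r₀) {v : ℂ} (hv : ‖v‖ < 1)
    (h0 : v ≠ 0) : f v ≠ 0 := fun h =>
  h0 (hf.injOn (mem_ball_zero_iff.2 hv) (by simp) (h.trans hf.map_zero.symm))

theorem dslope_interior_map_zero (hf : IsInteriorConformalMap D f r₀) : dslope f 0 0 = r₀ := by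
  rw [dslope_same, hf.hasDerivAt_zero.deriv]

theorem dslope_interior_map (hf : IsInteriorConformalMap D f r₀) {v : ℂ} (h0 : v ≠ 0) :
    dslope f 0 v = f v / v := by
  rw [dslope_of_ne _ h0, slope_def_field, hf.map_zero, sub_zero, sub_zero]

theorem dslope_interior_map_ne_zero (hf : IsInteriorConformalMap D f r₀) :
    ∀ v ∈ ball (0 : ℂ) 1, dslope f 0 v ≠ 0 := by
  intro v hv
  by_cases h0 : v = 0
  · rw [h0, dslope_interior_map_zero hf]
    exact_mod_cast hf.pos.ne'
  · rw [dslope_interior_map hf h0]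
    exact div_ne_zero (interior_map_ne_zero hf (mem_ball_zero_iff.1 hv) h0) h0

theorem differentiableOn_dslope_interior_map (hf : IsInteriorConformalMap D f r₀) :
    DifferentiableOn ℂ (dslope f 0) (ball 0 1) :=
  (differentiableOn_dslope (ball_mem_nhds 0 one_pos)).2 hf.differentiableOn

/-- The inversion `z ↦ 1 / f (1 / z)` of an interior conformal map. -/
theorem exists_isUnivalentAtInfinity_inversion (hf : IsInteriorConformalMap D f r₀) :
    ∃ c : ℕ → ℂ, IsUnivalentAtInfinity (fun z => (f z⁻¹)⁻¹) r₀⁻¹ c := by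
  have hr : (r₀ : ℂ) ≠ 0 := by exact_mod_cast hf.pos.ne'
  have hv : ∀ z : ℂ, 1 < ‖z‖ → ‖z⁻¹‖ < 1 ∧ z⁻¹ ≠ 0 ∧ z ≠ 0 := fun z hz => by
    have h0 : z ≠ 0 := by rintro rfl; simp at hz; linarith
    exact ⟨by rw [norm_inv]; exact inv_lt_one_of_one_lt₀ hz, inv_ne_zero h0, h0⟩
  -- With `h(v) = v / f(v)` and `h(0) = 1/r₀`, the difference `1/f(v) - 1/(r₀ v)` is `(h(v) - h(0))
  -- / v`, so the coefficients sought are the Taylor coefficients of `dslope h 0`.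
  set h : ℂ → ℂ := fun v => (dslope f 0 v)⁻¹ with hh
  have hhd : DifferentiableOn ℂ h (ball 0 1) :=
    (differentiableOn_dslope_interior_map hf).inv (dslope_interior_map_ne_zero hf)
  have hhd2 : DifferentiableOn ℂ (dslope h 0) (ball 0 1) :=
    (differentiableOn_dslope (ball_mem_nhds 0 one_pos)).2 hhd
  refine ⟨fun n => iteratedDeriv n (dslope h 0) 0 / n.factorial, ?_, ?_, ?_, ?_⟩
  · intro z hz
    obtain ⟨h1, h2, h3⟩ := hv z hz
    have h4 : DifferentiableAt ℂ f z⁻¹ :=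
      hf.differentiableOn.differentiableAt (isOpen_ball.mem_nhds (mem_ball_zero_iff.2 h1))
    exact ((h4.comp z (differentiableAt_inv h3)).inv
      (interior_map_ne_zero hf h1 h2)).differentiableWithinAt
  · intro z hz w hw hzw
    exact inv_injective (hf.injOn (mem_ball_zero_iff.2 (hv z hz).1)
      (mem_ball_zero_iff.2 (hv w hw).1) (inv_injective hzw))
  · intro z hz
    obtain ⟨h1, h2, h3⟩ := hv z hz
    have := hasSum_taylor_ball hhd2 h1
    convert this using 1
    rw [dslope_of_ne _ h2, slope_def_field]
    simp only [hh, dslope_interior_map_zero hf, dslope_interior_map hf h2]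
    push_cast
    field_simp
    ring
  · exact inv_pos.2 hf.pos

/-- The condition `w ≠ 0` is needed since `0⁻¹ = 0` lies in `D` when `0` does; the true preimage of
`w = 0` is infinity. -/
theorem image_inversion (hf : IsInteriorConformalMap D f r₀) :
    (fun z => (f z⁻¹)⁻¹) '' {z | 1 < ‖z‖} = {w | w⁻¹ ∈ D ∧ w ≠ 0} := by
  ext w
  constructor
  · rintro ⟨z, hz, rfl⟩
    have h0 : z ≠ 0 := by rintro rfl; simp at hz; linarith
    have h1 : ‖z⁻¹‖ < 1 := by rw [norm_inv]; exact inv_lt_one_of_one_lt₀ hz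
    refine ⟨?_, inv_ne_zero (interior_map_ne_zero hf h1 (inv_ne_zero h0))⟩
    rw [inv_inv, ← hf.image_eq]
    exact ⟨z⁻¹, mem_ball_zero_iff.2 h1, rfl⟩
  · rintro ⟨hw, hw0⟩
    rw [← hf.image_eq] at hw
    obtain ⟨v, hv, hvw⟩ := hw
    have hv0 : v ≠ 0 := by
      rintro rfl
      rw [hf.map_zero] at hvw
      exact hw0 (inv_eq_zero.1 hvw.symm)
    refine ⟨v⁻¹, ?_, ?_⟩
    · change 1 < ‖v⁻¹‖
      rw [norm_inv]
      exact (one_lt_inv₀ (norm_pos_iff.2 hv0)).2 (mem_ball_zero_iff.1 hv)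
    · simp [hvw]

/-- The interior Grunsky coefficients, from those of the inversion and from the Taylor coefficients
`t` of `log (f ζ / ζ)`. -/
noncomputable def interiorCoeff (r : ℝ) (c t : ℕ → ℂ) (k l : ℕ) : ℂ :=
  if l = 0 then -t k else if k = 0 then -t l else grunskyCoeff r c k.toPNat' l.toPNat'

theorem hasSum_interiorCoeff {r : ℝ} {c t : ℕ → ℂ} {ζ z L Λ₁ Λ₂ : ℂ}
    (hL : HasSum (fun p : ℕ+ × ℕ+ =>
      -(grunskyCoeff r c p.1 p.2 * ζ ^ (p.1 : ℕ) * z ^ (p.2 : ℕ))) L)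
    (h₁ : HasSum (fun k => t k * ζ ^ k) Λ₁) (h₂ : HasSum (fun l => t l * z ^ l) Λ₂) :
    HasSum (fun p : ℕ × ℕ => -(interiorCoeff r c t p.1 p.2 * ζ ^ p.1 * z ^ p.2))
      (L + Λ₁ + Λ₂ - t 0) := by
  have e1 : Function.Injective fun p : ℕ+ × ℕ+ => ((p.1 : ℕ), (p.2 : ℕ)) := fun p q h =>
    Prod.ext (PNat.coe_injective (Prod.mk.inj h).1) (PNat.coe_injective (Prod.mk.inj h).2)
  have e2 : Function.Injective fun k : ℕ => (k, 0) := fun p q h => (Prod.mk.inj h).1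
  have e3 : Function.Injective fun k : ℕ => (0, k) := fun p q h => (Prod.mk.inj h).2
  have s1 : HasSum (fun p : ℕ × ℕ => if p.1 ≠ 0 ∧ p.2 ≠ 0 then
      -(grunskyCoeff r c p.1.toPNat' p.2.toPNat' * ζ ^ p.1 * z ^ p.2) else 0) L := by
    rw [← e1.hasSum_iff]
    · refine hL.congr_fun fun p => ?_
      simp
    · intro p hp
      rw [if_neg]
      rintro ⟨h3, h4⟩
      exact hp ⟨(⟨p.1, Nat.pos_of_ne_zero h3⟩, ⟨p.2, Nat.pos_of_ne_zero h4⟩), rfl⟩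
  have s2 : HasSum (fun p : ℕ × ℕ => if p.2 = 0 then t p.1 * ζ ^ p.1 else 0) Λ₁ := by
    rw [← e2.hasSum_iff]
    · exact h₁.congr_fun fun k => by simp
    · intro p hp
      exact if_neg fun h => hp ⟨p.1, Prod.ext rfl h.symm⟩
  have s3 : HasSum (fun p : ℕ × ℕ => if p.1 = 0 then t p.2 * z ^ p.2 else 0) Λ₂ := by
    rw [← e3.hasSum_iff]
    · exact h₂.congr_fun fun k => by simp
    · intro p hp
      exact if_neg fun h => hp ⟨p.2, Prod.ext h.symm rfl⟩
  -- The row and the column both contain the constant term `t 0`, so it is subtracted once.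
  have s4 : HasSum (fun p : ℕ × ℕ => if p = (0, 0) then t 0 else 0) (t 0) := hasSum_ite_eq _ _
  refine (((s1.add s2).add s3).sub s4).congr_fun fun p => ?_
  obtain ⟨k, l⟩ := p
  by_cases hk : k = 0 <;> by_cases hl : l = 0 <;> simp [interiorCoeff, hk, hl]

/-- With `G(z) = 1/f(1/z)`, the logarithm of the difference quotient of `f` is that of `G` at `1/ζ,
1/z`, normalized by `1/r₀`, plus `log(f(ζ)/ζ) + log(f(z)/z) - log r₀`. The added terms only affect
coefficients with a zero index. -/
theorem isInteriorGrunskyCoeff (hf : IsInteriorConformalMap D f r₀) {c : ℕ → ℂ}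
    (hg : IsUnivalentAtInfinity (fun z => (f z⁻¹)⁻¹) r₀⁻¹ c) :
    ∃ t : ℕ → ℂ, IsInteriorGrunskyCoeff f r₀ (interiorCoeff r₀⁻¹ c t) := by
  have hr : (r₀ : ℂ) ≠ 0 := by exact_mod_cast hf.pos.ne'
  have hexp0 : cexp (Real.log r₀ : ℂ) = r₀ := by
    rw [← ofReal_exp, Real.exp_log hf.pos]
  obtain ⟨Λ, hΛd, hΛ0, hΛ⟩ := exists_log_on_ball (differentiableOn_dslope_interior_map hf)
    (dslope_interior_map_ne_zero hf) (ℓ := (Real.log r₀ : ℂ))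
    (hexp0.trans (dslope_interior_map_zero hf).symm)
  set t : ℕ → ℂ := fun n => iteratedDeriv n Λ 0 / n.factorial with ht
  have ht0 : t 0 = (Real.log r₀ : ℂ) := by simp [ht, hΛ0]
  refine ⟨t, by simp [interiorCoeff, ht0], fun ζ z hζ hz hne => ?_⟩
  have h₁ := hasSum_taylor_ball hΛd hζ
  have h₂ := hasSum_taylor_ball hΛd hz
  have hzero : ζ = 0 ∨ z = 0 → HasSum (fun p : ℕ+ × ℕ+ =>
      -(grunskyCoeff r₀⁻¹ c p.1 p.2 * ζ ^ (p.1 : ℕ) * z ^ (p.2 : ℕ))) 0 := by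
    intro h
    refine hasSum_zero.congr_fun fun p => ?_
    rcases h with rfl | rfl <;> simp
  by_cases hζ0 : ζ = 0
  · refine ⟨_, hasSum_interiorCoeff (hzero (Or.inl hζ0)) h₁ h₂, ?_⟩
    subst hζ0
    have hz0 : z ≠ 0 := hne.symm
    rw [ht0, hΛ0, zero_add, add_sub_cancel_left, hΛ z (mem_ball_zero_iff.2 hz),
      dslope_interior_map hf hz0, hf.map_zero, zero_sub, zero_sub, neg_div_neg_eq]
  by_cases hz0 : z = 0
  · refine ⟨_, hasSum_interiorCoeff (hzero (Or.inr hz0)) h₁ h₂, ?_⟩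
    subst hz0
    rw [ht0, hΛ0, zero_add, add_sub_cancel_right, hΛ ζ (mem_ball_zero_iff.2 hζ),
      dslope_interior_map hf hζ0, hf.map_zero, sub_zero, sub_zero]
  have hinv : ∀ v : ℂ, ‖v‖ < 1 → v ≠ 0 → 1 < ‖v⁻¹‖ := fun v hv h0 => by
    rw [norm_inv]; exact (one_lt_inv₀ (norm_pos_iff.2 h0)).2 hv
  obtain ⟨L, hL, hLexp⟩ := hg.isExteriorGrunskyCoeff ζ⁻¹ z⁻¹ (hinv ζ hζ hζ0) (hinv z hz hz0)
    (inv_injective.ne hne)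
  simp only [inv_inv] at hL hLexp
  refine ⟨_, hasSum_interiorCoeff hL h₁ h₂, ?_⟩
  rw [ht0, Complex.exp_sub, Complex.exp_add, Complex.exp_add, hLexp, hexp0,
    hΛ z (mem_ball_zero_iff.2 hz), hΛ ζ (mem_ball_zero_iff.2 hζ), dslope_interior_map hf hz0,
    dslope_interior_map hf hζ0]
  have hfz := interior_map_ne_zero hf hz hz0
  have hfζ := interior_map_ne_zero hf hζ hζ0
  have hs1 : ζ - z ≠ 0 := sub_ne_zero.2 hne
  have hs2 : ζ⁻¹ - z⁻¹ = (z - ζ) / (ζ * z) := by field_simp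
  have hs3 : (f ζ)⁻¹ - (f z)⁻¹ = (f z - f ζ) / (f ζ * f z) := by field_simp
  have hs4 : z - ζ ≠ 0 := sub_ne_zero.2 hne.symm
  rw [hs2, hs3, ofReal_inv]
  field_simp
  ring

end InteriorMap

/-! ### Logarithmic form and the topology of the complement. -/

section Main

open Complex Set Metric
open scoped Real

variable {D : Set ℂ}

theorem log_partitionFn {n : ℕ} {r Z : ℝ} (hr : 0 < r) (hZ : 0 < Z) {d : ℂ}
    (hd : d = ((n.factorial / π ^ n * r⁻¹ ^ (n * (n + 1)) * Z : ℝ) : ℂ)) :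
    d.im = 0 ∧ 0 < d.re ∧ Real.log Z =
      Real.log (π ^ n / (n.factorial : ℝ)) + (n : ℝ) * ((n : ℝ) + 1) * Real.log r
        + Real.log d.re := by
  have hn : (0 : ℝ) < n.factorial := by exact_mod_cast n.factorial_pos
  have hpi : 0 < π ^ n := pow_pos Real.pi_pos n
  have hrp : 0 < r⁻¹ ^ (n * (n + 1)) := pow_pos (inv_pos.2 hr) _
  rw [hd, ofReal_im, ofReal_re]
  refine ⟨rfl, by positivity, ?_⟩
  rw [Real.log_mul (by positivity) hZ.ne', Real.log_mul (by positivity) hrp.ne', Real.log_pow,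
    Real.log_inv, Real.log_div hpi.ne' hn.ne', Real.log_div hn.ne' hpi.ne']
  push_cast
  ring

theorem compl_union_exteriorDomain (hD : IsOpen D) :
    (D ∪ exteriorDomain D)ᶜ = frontier D := by
  rw [compl_union, exteriorDomain, compl_compl, hD.frontier_eq, sdiff_eq, inter_comm]

theorem disjoint_exteriorDomain : Disjoint D (exteriorDomain D) :=
  disjoint_left.2 fun _ hz h => h (subset_closure hz)

theorem isOpen_inversion {Ω : Set ℂ} (hΩ : IsOpen Ω) (h0 : (0 : ℂ) ∉ Ω) :
    IsOpen ((fun z : ℂ => z⁻¹) '' Ω) := by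
  have h1 : (fun z : ℂ => z⁻¹) '' Ω = {0}ᶜ ∩ (fun z : ℂ => z⁻¹) ⁻¹' Ω := by
    ext w
    constructor
    · rintro ⟨z, hz, rfl⟩
      have : z ≠ 0 := fun h => h0 (h ▸ hz)
      exact ⟨by simpa using this, by simpa using hz⟩
    · rintro ⟨_, hw⟩
      exact ⟨w⁻¹, hw, inv_inv w⟩
  rw [h1]
  exact continuousOn_inv₀.isOpen_inter_preimage isOpen_compl_singleton hΩ

end Main

end Grunsky

theorem proposition1p1 (D : Set ℂ) (hD : IsBoundedJordanDomain D) (h0 : (0 : ℂ) ∈ D)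
    (hnull : volume (frontier D) = 0) :
    (∀ (g : ℂ → ℂ) (r : ℝ), IsExteriorConformalMap D g r →
      ∃ (a : ℕ+ → ℕ+ → ℂ) (B : EllTwo →L[ℂ] EllTwo),
        IsExteriorGrunskyCoeff g r a ∧ IsGrunskyOperator a B ∧
        ∀ n : ℕ, 1 ≤ n →
          IntegrableOn (coulombWeight n) (configSpace n D) ∧
          0 < partitionFn n D ∧
          (truncDet n B).im = 0 ∧ 0 < (truncDet n B).re ∧
          Real.log (partitionFn n D) =
            Real.log (Real.pi ^ n / (n.factorial : ℝ)) + (n : ℝ) * ((n : ℝ) + 1) * Real.log r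
              + Real.log (truncDet n B).re) ∧
    (∀ (f : ℂ → ℂ) (r₀ : ℝ), IsInteriorConformalMap D f r₀ →
      ∃ (a : ℕ → ℕ → ℂ) (B₁ : EllTwo →L[ℂ] EllTwo),
        IsInteriorGrunskyCoeff f r₀ a ∧
        IsGrunskyOperator (fun k l : ℕ+ => a k l) B₁ ∧
        ∀ n : ℕ, 1 ≤ n →
          IntegrableOn (exteriorCoulombWeight n) (configSpace n (exteriorDomain D)) ∧
          0 < exteriorPartitionFn n (exteriorDomain D) ∧
          (truncDet n B₁).im = 0 ∧ 0 < (truncDet n B₁).re ∧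
          Real.log (exteriorPartitionFn n (exteriorDomain D)) =
            Real.log (Real.pi ^ n / (n.factorial : ℝ)) - (n : ℝ) * ((n : ℝ) + 1) * Real.log r₀
              + Real.log (truncDet n B₁).re) := by
  obtain ⟨hDo, hDc, hDb, -⟩ := hD
  refine ⟨fun g r hg => ?_, fun f r₀ hf => ?_⟩
  · obtain ⟨c, hc⟩ := hg.expansion
    have hu : Grunsky.IsUnivalentAtInfinity g r c := ⟨hg.differentiableOn, hg.injOn, hc, hg.pos⟩
    obtain ⟨B, hB, hn⟩ := hu.partitionFn_compl hDo ⟨0, h0⟩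
      (by rw [hg.image_eq]; exact Grunsky.disjoint_exteriorDomain)
      (by rw [hg.image_eq, Grunsky.compl_union_exteriorDomain hDo]; exact hnull)
    refine ⟨Grunsky.grunskyCoeff r c, B, hu.isExteriorGrunskyCoeff, hB, fun n _ => ?_⟩
    obtain ⟨h1, h2, h3⟩ := hn n
    exact ⟨h1, h2, Grunsky.log_partitionFn hg.pos h2 h3⟩
  · obtain ⟨c, hu⟩ := Grunsky.exists_isUnivalentAtInfinity_inversion hf
    obtain ⟨t, ht⟩ := Grunsky.isInteriorGrunskyCoeff hf hu
    have hEo : IsOpen (exteriorDomain D) := isClosed_closure.isOpen_compl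
    have hE0 : (0 : ℂ) ∉ exteriorDomain D := fun h => h (subset_closure h0)
    have himg := Grunsky.image_inversion hf
    have hdisj : Disjoint ((fun z : ℂ => z⁻¹) '' exteriorDomain D)
        ((fun z => (f z⁻¹)⁻¹) '' {z | 1 < ‖z‖}) := by
      rw [himg, Set.disjoint_left]
      rintro _ ⟨z, hz, rfl⟩ ⟨h1, -⟩
      rw [inv_inv] at h1
      exact hz (subset_closure h1)
    have hne : ((fun z : ℂ => z⁻¹) '' exteriorDomain D).Nonempty := by
      refine Set.Nonempty.image _ (Set.nonempty_compl.2 fun h => ?_)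
      exact NormedSpace.unbounded_univ ℂ ℂ (h ▸ hDb.closure)
    -- What is left out is the inverted boundary, null because inversion is differentiable away from
    -- `0 ∈ D`, and the point `0`, the image of infinity.
    have hnull' : volume (((fun z : ℂ => z⁻¹) '' exteriorDomain D) ∪
        (fun z => (f z⁻¹)⁻¹) '' {z | 1 < ‖z‖})ᶜ = 0 := by
      have h1 : volume ((fun z : ℂ => z⁻¹) '' frontier D) = 0 := by
        refine addHaar_image_eq_zero_of_differentiableOn_of_addHaar_eq_zero _ (fun z hz => ?_) hnull
        have hz0 : z ≠ 0 := by
          rintro rfl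
          rw [hDo.frontier_eq] at hz
          exact hz.2 h0
        exact ((differentiableAt_inv (𝕜 := ℂ) hz0).restrictScalars ℝ).differentiableWithinAt
      refine measure_mono_null (t := {0} ∪ (fun z : ℂ => z⁻¹) '' frontier D) (fun w hw => ?_)
        (measure_union_null (measure_singleton 0) h1)
      rw [himg, Set.mem_compl_iff, Set.mem_union, not_or] at hw
      by_cases hw0 : w = 0
      · exact Or.inl hw0
      · refine Or.inr ⟨w⁻¹, ?_, inv_inv w⟩
        rw [← Grunsky.compl_union_exteriorDomain hDo, Set.mem_compl_iff, Set.mem_union, not_or]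
        exact ⟨fun h => hw.2 ⟨h, hw0⟩, fun h => hw.1 ⟨w⁻¹, h, inv_inv w⟩⟩
    obtain ⟨B, hB, hn⟩ := hu.partitionFn_compl (Grunsky.isOpen_inversion hEo hE0) hne hdisj hnull'
    have hbd : Bornology.IsBounded ((fun z : ℂ => z⁻¹) '' exteriorDomain D) := by
      obtain ⟨R, hR⟩ := hu.exists_compl_image_subset le_rfl
      exact Metric.isBounded_closedBall.subset (fun w hw => hR (Set.disjoint_left.1 hdisj hw))
    refine ⟨_, B, ht, fun k l => ?_, fun n _ => ?_⟩
    · rw [hB k l]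
      simp [Grunsky.interiorCoeff]
    · obtain ⟨-, h2, h3⟩ := hn n
      obtain ⟨h4, h5⟩ := Grunsky.exteriorPartitionFn_eq n hEo.measurableSet hE0 hbd
      rw [← h5] at h2 h3
      -- The leading coefficient of the inverted map is `r₀⁻¹`, whence the minus sign in front of
      -- `log r₀`.
      obtain ⟨h6, h7, h8⟩ := Grunsky.log_partitionFn (inv_pos.2 hf.pos) h2 h3
      refine ⟨h4, h2, h6, h7, ?_⟩
      rw [h8, Real.log_inv]
      ring
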